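/- Let $n\ge 2$, $k\ge 1$, $\alpha\ge 0$. For Schwartz functions $f_1,\dots,f_k:\mathbb{R}^n\to\mathbb{C}$ and $x\in\mathbb{R}^n$ put $$B^{k,\alpha}_R(f_1,\dots,f_k)(x)=\int_{(\mathbb{R}^{n})^k}m^\alpha(R^{-1}\xi)\prod_{\iota=1}^k\widehat f_\iota(\xi_\iota)\,e^{2\pi i x\cdot(\xi_1+\cdots+\xi_k)}\,d\xi,\qquad B^{k,\alpha}_*(f_1,\dots,f_k)(x)=\sup_{R>0}\big|B^{k,\alpha}_R(f_1,\dots,f_k)(x)\big|,$$ where $\widehat f(\eta)=\int_{\mathbb{R}^n} f(y)e^{-2\pi i y\cdot\eta}\,dy$ and, for $\xi=(\xi_1,\dots,\xi_k)\in(\mathbb{R}^n)^k$, $m^\alpha(\xi)=(1-|\xi|^2)^\alpha$ if $|\xi|<1$ and $m^\alpha(\xi)=0$ otherwise. Let $0<p\le\infty$ and $0<p_1,\dots,p_k\le\infty$ (with $1/\infty=0$). If $$\alpha<\frac{2n-1}{2p}-\frac{(n-1)k+1}{2},$$ then the maximal estimate $$\big\|B^{k,\alpha}_*(f_1,\dots,f_k)\big\|_{L^p(\mathbb{R}^n)}\le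 C\prod_{\iota=1}^k\|f_\iota\|_{L^{p_\iota}(\mathbb{R}^n)}$$ fails: there is no finite constant $C$ for which it holds for all Schwartz functions $f_1,\dots,f_k$. -/

import Mathlib

open MeasureTheory
open scoped ENNReal NNReal FourierTransform

noncomputable section

/-- The `k`-linear Bochner-Riesz multiplier `(1 - |ξ|²)₊ ^ α` on `(ℝⁿ)ᵏ`, where
`|ξ|² = |ξ₁|² + ⋯ + |ξₖ|²`. It vanishes for `|ξ| ≥ 1`; in particular, for `α = 0` it is the
indicator function of the open unit ball. -/
def bochnerRieszMultiplier {n k : ℕ} (α : ℝ) (ξ : Fin k → EuclideanSpace ℝ (Fin n)) : ℝ :=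
  if ∑ i, ‖ξ i‖ ^ 2 < 1 then (1 - ∑ i, ‖ξ i‖ ^ 2) ^ α else 0

/-- The multilinear Bochner-Riesz mean
`B_R(f₁, …, fₖ)(x) = ∫ m^α(R⁻¹ ξ) ∏ i, 𝓕 fᵢ(ξᵢ) e^{2π i x ⬝ (ξ₁ + ⋯ + ξₖ)} dξ`, where `dξ` is Lebesgue
measure on `(ℝⁿ)ᵏ` and `𝓕 f (η) = ∫ f(y) e^{-2π i y ⬝ η} dy`. -/
def bochnerRieszMean {n k : ℕ} (α R : ℝ) (f : Fin k → EuclideanSpace ℝ (Fin n) → ℂ)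
    (x : EuclideanSpace ℝ (Fin n)) : ℂ :=
  ∫ ξ : Fin k → EuclideanSpace ℝ (Fin n),
    (bochnerRieszMultiplier α (R⁻¹ • ξ) : ℂ) * (∏ i, 𝓕 (f i) (ξ i)) *
      Complex.exp (2 * Real.pi * Complex.I * ((inner ℝ x (∑ i, ξ i) : ℝ) : ℂ))

/-- The multilinear maximal Bochner-Riesz operator
`B_*(f₁, …, fₖ)(x) = sup_{R > 0} |B_R(f₁, …, fₖ)(x)|`, with values in `[0, ∞]`. -/
def maximalBochnerRiesz {n k : ℕ} (α : ℝ) (f : Fin k → EuclideanSpace ℝ (Fin n) → ℂ)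
    (x : EuclideanSpace ℝ (Fin n)) : ℝ≥0∞ :=
  ⨆ (R : ℝ) (_ : 0 < R), ‖bochnerRieszMean α R f x‖ₑ

end

/-!
The proof tests the maximal estimate on a single wave packet, repeated `k` times. Let `f` be a
Gaussian of frequency `e₁` which has width `√N` in the direction `e₁` and width `1` in the other
directions. At the points `x` with `x₁ ∼ N` and `|x'| ≲ N`, a suitable choice of the radius `R(x)`
removes the oscillation of the kernel across the support of `f`, in spite of its length `√N` in the
direction `e₁`. This gives `B_* (f, …, f) ≥ c N ^ (-α - 1/2 - (n - 1) k / 2)` on a set of measure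
`∼ N ^ n` (`exists_le_maximalBochnerRiesz_packet`).

Asymptotics of the kernel are avoided by an exact subordination formula
(`integral_rpow_mul_cexp_mul_bochnerRieszMean`). For `Re s > 0`, Euler's integral gives
`∫ v ^ α exp (-s v) B_√v dv = Γ(α + 1) s ^ (-α - 1) exp (-s |D|²)`, and the operator on the right
hand side factorizes over the `k` functions. On the line `s = 1 + it` it is a regularized Schrödinger
evolution, which acts on Gaussians explicitly. In place of a choice of `R(x)`, this identity is
averaged over `t` in a window of length `c √N` about the time at which the packet reaches `x`, against
a smooth weight with a linear phase. Two estimates give the lower bound for `B_*`.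

* The weighted evolution does not oscillate on the window: its phase is linear up to a small error,
  since the second derivative of the phase is `O(1 / N)` (`exists_evolvedGaussian_eq`,
  `evolvedPacket_near_passage`).
* The combination of the means `B_√v` that arises has total mass `O(N ^ (α + 1) / √N)`, because the
  weight is smooth on the scale of the window (`norm_integral_windowedPower_mul_cexp_le`,
  `norm_integral_window_evolution_le`).

No relation between `p` and the exponents `q i` is assumed. To treat all of them at once, the packet
is dilated by `l`, where `N = l ^ (2n)`, so that its widths have product one. Then all `L ^ q` norms of
the packet are independent of `l`, for every `q`, while the set on which `B_*` is large has measure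
`∼ N ^ (n - 1/2)`. As `l → ∞`, a maximal estimate would force
`(2n - 1) / p ≤ 2α + 1 + (n - 1) k`.
-/

/-! ### Schwartz Gaussians and their Fourier transforms -/

lemma exp_neg_mul_sq_mul_pow_bounded {κ : ℝ} (hκ : 0 < κ) (m : ℕ) :
    ∃ C, ∀ r : ℝ, 0 ≤ r → Real.exp (-κ * r ^ 2) * (1 + r) ^ m ≤ C := by
  obtain ⟨C, hC⟩ : ∃ C, ∀ r : ℝ, 0 ≤ r → (1 + r) ^ m * Real.exp (-(1 + r)) ≤ C := by
    refine ⟨m.factorial, fun r hr => ?_⟩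
    rw [Real.exp_neg, ← div_eq_mul_inv, div_le_iff₀ (Real.exp_pos _), mul_comm]
    have := Real.pow_div_factorial_le_exp (1 + r) (by positivity) m
    rwa [div_le_iff₀ (by positivity)] at this
  refine ⟨Real.exp (1 + 1 / (4 * κ)) * C, fun r hr => ?_⟩
  have h1 : -κ * r ^ 2 ≤ (1 + 1 / (4 * κ)) + -(1 + r) := by
    have h2 : 0 ≤ κ * (r - 1 / (2 * κ)) ^ 2 := by positivity
    have h3 : κ * (r - 1 / (2 * κ)) ^ 2 = κ * r ^ 2 - r + 1 / (4 * κ) := by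
      field_simp
      ring
    linarith
  calc Real.exp (-κ * r ^ 2) * (1 + r) ^ m
      ≤ Real.exp ((1 + 1 / (4 * κ)) + -(1 + r)) * (1 + r) ^ m := by gcongr
    _ = Real.exp (1 + 1 / (4 * κ)) * ((1 + r) ^ m * Real.exp (-(1 + r))) := by
        rw [Real.exp_add]; ring
    _ ≤ _ := by gcongr; exact hC r hr

lemma norm_iteratedFDeriv_real_cexp (i : ℕ) (w : ℂ) :
    ‖iteratedFDeriv ℝ i Complex.exp w‖ ≤ Real.exp w.re := by
  have h := (Complex.contDiff_exp (𝕜 := ℂ) (n := i)).contDiffAt (x := w)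
  have h1 := h.restrictScalars_iteratedFDeriv (𝕜 := ℝ)
  have h2 : iteratedFDeriv ℝ i Complex.exp w =
    (iteratedFDeriv ℂ i Complex.exp w).restrictScalars ℝ := h1.symm
  rw [h2, ContinuousMultilinearMap.norm_restrictScalars, norm_iteratedFDeriv_eq_norm_iteratedDeriv,
    iteratedDeriv_eq_iterate, Complex.iter_deriv_exp, Complex.norm_exp]

/-- The Schwartz function `exp ∘ Q`, for a function `Q` of temperate growth whose real part is at
most `-κ ‖x‖²`. -/
noncomputable def schwartzExp {E : Type*} [NormedAddCommGroup E] [NormedSpace ℝ E] (Q : E → ℂ)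
    (hQ : Q.HasTemperateGrowth) (κ : ℝ) (hκ : 0 < κ) (hre : ∀ x, (Q x).re ≤ -κ * ‖x‖ ^ 2) :
    SchwartzMap E ℂ where
  toFun x := Complex.exp (Q x)
  smooth' := (Complex.contDiff_exp (𝕜 := ℝ)).comp hQ.1
  decay' m n := by
    obtain ⟨k, C, hC0, hC⟩ := hQ.norm_iteratedFDeriv_le_uniform n
    obtain ⟨K, hK⟩ := exp_neg_mul_sq_mul_pow_bounded hκ (m + k * n)
    refine ⟨n.factorial * (C + 1) ^ n * K, fun x => ?_⟩
    have hx : 0 ≤ ‖x‖ := norm_nonneg x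
    have h1 : ‖iteratedFDeriv ℝ n (Complex.exp ∘ Q) x‖ ≤
        n.factorial * Real.exp (Q x).re * ((C + 1) * (1 + ‖x‖) ^ k) ^ n := by
      refine norm_iteratedFDeriv_comp_le (N := ((⊤ : ℕ∞) : WithTop ℕ∞))
        (Complex.contDiff_exp (𝕜 := ℝ)) hQ.1 (by exact_mod_cast le_top) x
        (fun i _ => norm_iteratedFDeriv_real_cexp i _) (fun i hi1 hin => ?_)
      have h2 : 1 ≤ (C + 1) * (1 + ‖x‖) ^ k :=
        one_le_mul_of_one_le_of_one_le (by linarith) (one_le_pow₀ (by linarith))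
      calc ‖iteratedFDeriv ℝ i Q x‖ ≤ C * (1 + ‖x‖) ^ k := hC i hin x
        _ ≤ (C + 1) * (1 + ‖x‖) ^ k := by gcongr; linarith
        _ ≤ _ := le_self_pow₀ h2 (by omega)
    calc ‖x‖ ^ m * ‖iteratedFDeriv ℝ n (Complex.exp ∘ Q) x‖
        ≤ (1 + ‖x‖) ^ m * (n.factorial * Real.exp (-κ * ‖x‖ ^ 2) *
            ((C + 1) * (1 + ‖x‖) ^ k) ^ n) := by
          gcongr
          · linarith
          · refine h1.trans ?_
            gcongr
            exact hre x
      _ = n.factorial * (C + 1) ^ n *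
          (Real.exp (-κ * ‖x‖ ^ 2) * (1 + ‖x‖) ^ (m + k * n)) := by
          rw [mul_pow, pow_add, pow_mul]; ring
      _ ≤ _ := by gcongr; exact hK _ hx

/-- The quadratic polynomial `∑ j, (-(π² / aⱼ) yⱼ² + 2π i cⱼ yⱼ)`, the logarithm of a modulated
anisotropic Gaussian. -/
noncomputable def gaussianExponent {n : ℕ} (a c : Fin n → ℝ) (y : EuclideanSpace ℝ (Fin n)) : ℂ :=
  ∑ j, (-((Real.pi ^ 2 / a j : ℝ) : ℂ) * ((y j : ℝ) : ℂ) ^ 2 +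
    2 * Real.pi * Complex.I * (c j : ℂ) * ((y j : ℝ) : ℂ))

lemma gaussianExponent_hasTemperateGrowth {n : ℕ} (a c : Fin n → ℝ) :
    (gaussianExponent a c).HasTemperateGrowth := by
  have hcoord : ∀ j : Fin n, Function.HasTemperateGrowth
      (fun y : EuclideanSpace ℝ (Fin n) => ((y j : ℝ) : ℂ)) := fun j =>
    Function.HasTemperateGrowth.comp Function.Complex.hasTemperateGrowth_ofReal
      (EuclideanSpace.proj j).hasTemperateGrowth
  unfold gaussianExponent
  refine Function.HasTemperateGrowth.sum fun j _ => ?_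
  exact ((Function.HasTemperateGrowth.const _).mul ((hcoord j).pow 2)).add
    ((Function.HasTemperateGrowth.const _).mul (hcoord j))

lemma gaussianExponent_re {n : ℕ} (a c : Fin n → ℝ) (y : EuclideanSpace ℝ (Fin n)) :
    (gaussianExponent a c y).re = ∑ j, -(Real.pi ^ 2 / a j) * y j ^ 2 := by
  rw [gaussianExponent, Complex.re_sum]
  refine Finset.sum_congr rfl fun j _ => ?_
  have h1 : -((Real.pi ^ 2 / a j : ℝ) : ℂ) * ((y j : ℝ) : ℂ) ^ 2 +
    2 * Real.pi * Complex.I * (c j : ℂ) * ((y j : ℝ) : ℂ) =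
    ((-(Real.pi ^ 2 / a j) * y j ^ 2 : ℝ) : ℂ) +
      ((2 * Real.pi * c j * y j : ℝ) : ℂ) * Complex.I := by push_cast; ring
  rw [h1]
  simp [-Complex.ofReal_mul, -Complex.ofReal_div, -Complex.ofReal_pow, -Complex.ofReal_neg]

lemma exists_gaussianExponent_re_le {n : ℕ} {a : Fin n → ℝ} (ha : ∀ j, 0 < a j)
    (c : Fin n → ℝ) :
    ∃ κ : ℝ, 0 < κ ∧ ∀ y, (gaussianExponent a c y).re ≤ -κ * ‖y‖ ^ 2 := by
  refine ⟨Real.pi ^ 2 / (1 + ∑ j, a j), ?_, fun y => ?_⟩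
  · have : 0 ≤ ∑ j, a j := Finset.sum_nonneg fun j _ => (ha j).le
    positivity
  · rw [gaussianExponent_re, EuclideanSpace.real_norm_sq_eq, Finset.mul_sum]
    refine Finset.sum_le_sum fun j _ => ?_
    have h1 : a j ≤ 1 + ∑ j, a j := by
      have := Finset.single_le_sum (f := a) (fun i _ => (ha i).le) (Finset.mem_univ j)
      linarith
    have h2 := ha j
    have : Real.pi ^ 2 / (1 + ∑ j, a j) ≤ Real.pi ^ 2 / a j := by gcongr
    nlinarith [sq_nonneg (y j)]

/-- The modulated Gaussian `∏ j, exp (-(π² / aⱼ) yⱼ² + 2π i cⱼ yⱼ)` as a Schwartz function. -/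
noncomputable def modulatedGaussian {n : ℕ} (a c : Fin n → ℝ) (ha : ∀ j, 0 < a j) :
    SchwartzMap (EuclideanSpace ℝ (Fin n)) ℂ :=
  schwartzExp (gaussianExponent a c) (gaussianExponent_hasTemperateGrowth a c)
    (exists_gaussianExponent_re_le ha c).choose
    (exists_gaussianExponent_re_le ha c).choose_spec.1
    (exists_gaussianExponent_re_le ha c).choose_spec.2

lemma modulatedGaussian_apply {n : ℕ} (a c : Fin n → ℝ) (ha : ∀ j, 0 < a j)
    (y : EuclideanSpace ℝ (Fin n)) :
    modulatedGaussian a c ha y = Complex.exp (gaussianExponent a c y) := rfl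

/-- The Gaussian integral over Euclidean space with a separate complex quadratic and linear
coefficient for each coordinate. -/
lemma integral_euclidean_cexp_sum {n : ℕ} {b : Fin n → ℂ} (hb : ∀ j, 0 < (b j).re)
    (d e : Fin n → ℂ) :
    ∫ y : EuclideanSpace ℝ (Fin n),
      Complex.exp (∑ j, (-b j * ((y j : ℝ) : ℂ) ^ 2 + d j * ((y j : ℝ) : ℂ) + e j)) =
      ∏ j, (Real.pi / b j) ^ (1 / 2 : ℂ) * Complex.exp (e j + d j ^ 2 / (4 * b j)) := by
  rw [← (PiLp.volume_preserving_toLp (Fin n)).integral_comp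
    (MeasurableEquiv.toLp 2 (Fin n → ℝ)).measurableEmbedding]
  simp_rw [Complex.exp_sum]
  rw [integral_fintype_prod_volume_eq_prod
    (f := fun j (v : ℝ) => Complex.exp (-b j * (v : ℂ) ^ 2 + d j * (v : ℂ) + e j))]
  refine Finset.prod_congr rfl fun j _ => ?_
  rw [integral_cexp_quadratic (by simpa using hb j), neg_neg]
  congr 2
  rw [mul_neg, div_neg, sub_neg_eq_add]

lemma fourier_modulatedGaussian {n : ℕ} (a c : Fin n → ℝ) (ha : ∀ j, 0 < a j)
    (ξ : EuclideanSpace ℝ (Fin n)) :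
    𝓕 (modulatedGaussian a c ha : EuclideanSpace ℝ (Fin n) → ℂ) ξ =
      (∏ j, (Real.sqrt (a j / Real.pi) : ℂ)) *
        Complex.exp (∑ j, (-(a j : ℂ) * (((ξ j : ℝ) : ℂ) - c j) ^ 2)) := by
  have hpi := Real.pi_pos
  have h0 : ∀ j, 0 < (((Real.pi ^ 2 / a j : ℝ) : ℂ)).re := fun j => by
    have := ha j
    rw [Complex.ofReal_re]; positivity
  have h1 := integral_euclidean_cexp_sum h0
    (fun j => 2 * Real.pi * Complex.I * ((c j : ℂ) - ((ξ j : ℝ) : ℂ))) (fun _ => 0)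
  rw [Real.fourier_eq', Complex.exp_sum, ← Finset.prod_mul_distrib]
  convert h1 using 1
  · refine integral_congr_ae (.of_forall fun y => ?_)
    simp only [modulatedGaussian_apply, smul_eq_mul, ← Complex.exp_add]
    congr 1
    rw [gaussianExponent, PiLp.inner_apply]
    push_cast
    rw [Finset.mul_sum, Finset.sum_mul, ← Finset.sum_add_distrib]
    refine Finset.sum_congr rfl fun j _ => ?_
    simp
    ring
  · refine Finset.prod_congr rfl fun j _ => ?_
    have haj := ha j
    have hne : (a j : ℂ) ≠ 0 := by exact_mod_cast haj.ne'
    have hpine : (Real.pi : ℂ) ≠ 0 := by exact_mod_cast hpi.ne'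
    congr 1
    · rw [Real.sqrt_eq_rpow, Complex.ofReal_cpow (by positivity)]
      congr 1
      · push_cast; field_simp
      · norm_num
    · congr 1
      push_cast
      field_simp
      rw [Complex.I_sq]
      ring

/-- The complex Gaussian multiplier `exp (-s |ξ|²)`, applied to the modulated Gaussian. -/
lemma integral_cexp_mul_fourier_modulatedGaussian {n : ℕ} (a c : Fin n → ℝ) (ha : ∀ j, 0 < a j)
    {s : ℂ} (hs : 0 < s.re) (x : EuclideanSpace ℝ (Fin n)) :
    ∫ ξ : EuclideanSpace ℝ (Fin n), Complex.exp (-s * (‖ξ‖ : ℂ) ^ 2) *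
      (𝓕 (modulatedGaussian a c ha : EuclideanSpace ℝ (Fin n) → ℂ) ξ *
        Complex.exp (2 * Real.pi * Complex.I * ((inner ℝ x ξ : ℝ) : ℂ))) =
      ∏ j, ((Real.sqrt (a j / Real.pi) : ℂ) * ((Real.pi / (a j + s)) ^ (1 / 2 : ℂ) *
        Complex.exp (-(a j : ℂ) * c j ^ 2 +
          (a j * c j + Real.pi * Complex.I * ((x j : ℝ) : ℂ)) ^ 2 / (a j + s)))) := by
  have h0 : ∀ j, 0 < (a j + s).re := fun j => by
    have := ha j
    rw [Complex.add_re, Complex.ofReal_re]; positivity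
  have h1 := integral_euclidean_cexp_sum h0
    (fun j => 2 * (a j * c j + Real.pi * Complex.I * ((x j : ℝ) : ℂ)))
    (fun j => -(a j : ℂ) * c j ^ 2)
  rw [Finset.prod_mul_distrib]
  have h2 : ∀ j, (2 * ((a j : ℂ) * c j + Real.pi * Complex.I * ((x j : ℝ) : ℂ))) ^ 2 /
      (4 * (a j + s)) =
      (a j * c j + Real.pi * Complex.I * ((x j : ℝ) : ℂ)) ^ 2 / (a j + s) := fun j => by
    rw [mul_pow, show (2 : ℂ) ^ 2 = 4 by norm_num, mul_div_mul_left _ _ (by norm_num)]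
  simp only [h2] at h1
  rw [← h1, ← integral_const_mul]
  refine integral_congr_ae (.of_forall fun ξ => ?_)
  simp only [fourier_modulatedGaussian]
  have h3 : ∀ A B C D : ℂ, A * (B * C * D) = B * (A * (C * D)) := fun _ _ _ _ => by ring
  rw [h3, ← Complex.exp_add, ← Complex.exp_add]
  congr 2
  have h4 : (‖ξ‖ : ℂ) ^ 2 = ∑ j, ((ξ j : ℝ) : ℂ) ^ 2 := by
    exact_mod_cast congrArg (fun r : ℝ => (r : ℂ)) (EuclideanSpace.real_norm_sq_eq ξ)
  rw [h4, PiLp.inner_apply]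
  push_cast
  rw [Finset.mul_sum, Finset.mul_sum, ← Finset.sum_add_distrib, ← Finset.sum_add_distrib]
  refine Finset.sum_congr rfl fun j _ => ?_
  simp
  ring

/-! ### Dilations, and the Gamma integral for complex parameters -/

lemma fourier_comp_smul {n : ℕ} (g : EuclideanSpace ℝ (Fin n) → ℂ) {l : ℝ} (hl : 0 < l)
    (ξ : EuclideanSpace ℝ (Fin n)) :
    𝓕 (fun y => g (l • y)) ξ = ((l ^ n)⁻¹ : ℝ) * 𝓕 g (l⁻¹ • ξ) := by
  rw [Real.fourier_eq', Real.fourier_eq']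
  have h := Measure.integral_comp_smul_of_nonneg (volume : Measure (EuclideanSpace ℝ (Fin n)))
    (fun y => Complex.exp (((-2 * Real.pi * inner ℝ y (l⁻¹ • ξ) : ℝ) : ℂ) * Complex.I) • g y) l
    (hR := hl.le)
  rw [finrank_euclideanSpace_fin] at h
  rw [← Complex.real_smul, ← h]
  refine integral_congr_ae (.of_forall fun y => ?_)
  simp only [real_inner_smul_left, real_inner_smul_right, inv_mul_cancel_left₀ hl.ne']

lemma bochnerRieszMean_comp_smul {n k : ℕ} (α R : ℝ)
    (f : Fin k → EuclideanSpace ℝ (Fin n) → ℂ) {l : ℝ} (hl : 0 < l)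
    (x : EuclideanSpace ℝ (Fin n)) :
    bochnerRieszMean α R (fun i y => f i (l • y)) x =
      bochnerRieszMean α (l⁻¹ * R) f (l • x) := by
  unfold bochnerRieszMean
  have h := Measure.integral_comp_smul_of_nonneg
    (volume : Measure (Fin k → EuclideanSpace ℝ (Fin n)))
    (fun ξ => (bochnerRieszMultiplier α ((l⁻¹ * R)⁻¹ • ξ) : ℂ) * (∏ i, 𝓕 (f i) (ξ i)) *
      Complex.exp (2 * Real.pi * Complex.I * ((inner ℝ (l • x) (∑ i, ξ i) : ℝ) : ℂ))) l⁻¹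
    (hR := (inv_pos.2 hl).le)
  have hdim : Module.finrank ℝ (Fin k → EuclideanSpace ℝ (Fin n)) = n * k := by
    rw [Module.finrank_pi_fintype]
    simp [mul_comm]
  rw [hdim] at h
  have h2 : ∫ ξ, (bochnerRieszMultiplier α ((l⁻¹ * R)⁻¹ • ξ) : ℂ) * (∏ i, 𝓕 (f i) (ξ i)) *
      Complex.exp (2 * Real.pi * Complex.I * ((inner ℝ (l • x) (∑ i, ξ i) : ℝ) : ℂ)) =
      ((l ^ (n * k))⁻¹ : ℝ) • ∫ ξ, (bochnerRieszMultiplier α ((l⁻¹ * R)⁻¹ • (l⁻¹ • ξ)) : ℂ) *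
      (∏ i, 𝓕 (f i) ((l⁻¹ • ξ) i)) * Complex.exp (2 * Real.pi * Complex.I *
        ((inner ℝ (l • x) (∑ i, (l⁻¹ • ξ) i) : ℝ) : ℂ)) := by
    rw [h, smul_smul, inv_pow, inv_inv, inv_mul_cancel₀ (by positivity), one_smul]
  rw [h2, ← integral_smul]
  refine integral_congr_ae (.of_forall fun ξ => ?_)
  have h3 : (l⁻¹ * R)⁻¹ • (l⁻¹ • ξ) = R⁻¹ • ξ := by
    rw [smul_smul]
    congr 1
    rw [mul_inv, inv_inv, mul_comm l, mul_assoc, mul_inv_cancel₀ hl.ne', mul_one]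
  have h4 : (inner ℝ (l • x) (∑ i, (l⁻¹ • ξ) i) : ℝ) = inner ℝ x (∑ i, ξ i) := by
    simp only [Pi.smul_apply]
    rw [← Finset.smul_sum, real_inner_smul_left, real_inner_smul_right,
      mul_inv_cancel_left₀ hl.ne']
  simp only [h3, h4]
  simp only [Pi.smul_apply]
  simp_rw [fourier_comp_smul _ hl]
  rw [Finset.prod_mul_distrib, Finset.prod_const, Finset.card_univ, Fintype.card_fin,
    Complex.real_smul]
  push_cast
  rw [← inv_pow, ← inv_pow, ← pow_mul]
  ring

/-- The maximal operator commutes with dilations. -/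
lemma maximalBochnerRiesz_comp_smul {n k : ℕ} (α : ℝ)
    (f : Fin k → EuclideanSpace ℝ (Fin n) → ℂ) {l : ℝ} (hl : 0 < l)
    (x : EuclideanSpace ℝ (Fin n)) :
    maximalBochnerRiesz α (fun i y => f i (l • y)) x = maximalBochnerRiesz α f (l • x) := by
  unfold maximalBochnerRiesz
  refine le_antisymm (iSup₂_le fun R hR => ?_) (iSup₂_le fun R hR => ?_)
  · rw [bochnerRieszMean_comp_smul α R f hl]
    exact le_iSup₂_of_le (l⁻¹ * R) (by positivity) le_rfl
  · refine le_iSup₂_of_le (l * R) (by positivity) ?_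
    rw [bochnerRieszMean_comp_smul α _ f hl, inv_mul_cancel_left₀ hl.ne']

/-- Euler's integral `∫ v ^ α exp (-s v) = Γ(α + 1) / s ^ (α + 1)` for `s` in the right half-plane,
obtained from the case of real `s` by analytic continuation. -/
lemma integral_rpow_mul_cexp_neg_mul {α : ℝ} (hα : 0 ≤ α) {s : ℂ} (hs : 0 < s.re) :
    ∫ v in Set.Ioi (0 : ℝ), ((v ^ α : ℝ) : ℂ) * Complex.exp (-s * v) =
      (Real.Gamma (α + 1) : ℂ) * (1 / s) ^ ((α : ℂ) + 1) := by
  set μ : Measure ℝ := (volume.restrict (Set.Ioi 0)).withDensity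
    (fun v => ((Real.toNNReal (v ^ α) : ℝ≥0) : ℝ≥0∞)) with hμ
  have hmeas : Measurable (fun v : ℝ => Real.toNNReal (v ^ α)) := by fun_prop
  have hint : ∀ t < 0, IntegrableOn (fun v : ℝ => v ^ α * Real.exp (t * v)) (Set.Ioi 0) := by
    intro t ht
    have := integrableOn_rpow_mul_exp_neg_mul_rpow (s := α) (p := 1) (b := -t) (by linarith)
      one_pos (by linarith)
    simpa using this
  have hset : Set.Iio (0 : ℝ) ⊆ ProbabilityTheory.integrableExpSet id μ := by
    intro t ht
    rw [ProbabilityTheory.integrableExpSet, Set.mem_ofPred_eq, hμ,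
      integrable_withDensity_iff_integrable_smul hmeas]
    refine (hint t ht).congr_fun (fun v hv => ?_) measurableSet_Ioi
    simp [NNReal.smul_def, Real.coe_toNNReal _ (Real.rpow_nonneg (le_of_lt hv) α)]
  have hmgf : ∀ z : ℂ, ProbabilityTheory.complexMGF id μ z =
      ∫ v in Set.Ioi (0 : ℝ), ((v ^ α : ℝ) : ℂ) * Complex.exp (z * v) := by
    intro z
    rw [ProbabilityTheory.complexMGF, hμ, integral_withDensity_eq_integral_smul hmeas]
    refine setIntegral_congr_fun measurableSet_Ioi fun v hv => ?_
    simp [NNReal.smul_def, Real.coe_toNNReal _ (Real.rpow_nonneg (le_of_lt hv) α)]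
  have hana1 : AnalyticOnNhd ℂ (ProbabilityTheory.complexMGF id μ) {z | z.re < 0} := by
    intro z hz
    refine ProbabilityTheory.analyticAt_complexMGF ?_
    exact interior_mono hset (by rw [interior_Iio]; exact hz)
  have hana2 : AnalyticOnNhd ℂ (fun z : ℂ => (Real.Gamma (α + 1) : ℂ) *
      (1 / (-z)) ^ ((α : ℂ) + 1)) {z | z.re < 0} := by
    refine DifferentiableOn.analyticOnNhd (fun z hz => ?_)
      (isOpen_lt Complex.continuous_re continuous_const)
    have hz' : z.re < 0 := hz
    have hne : -z ≠ 0 := fun h => by simp [neg_eq_zero.1 h] at hz'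
    refine DifferentiableAt.differentiableWithinAt ?_
    refine (DifferentiableAt.const_mul ?_ _)
    refine DifferentiableAt.cpow_const ?_ ?_
    · exact (differentiableAt_const _).div differentiableAt_id.neg hne
    · left
      rw [one_div, Complex.inv_re]
      have : 0 < Complex.normSq (-z) := Complex.normSq_pos.2 hne
      have h2 : 0 < (-z).re := by simpa using hz'
      positivity
  have hreal : ∀ t : ℝ, t < 0 → ProbabilityTheory.complexMGF id μ t =
      (Real.Gamma (α + 1) : ℂ) * (1 / (-(t : ℂ))) ^ ((α : ℂ) + 1) := by
    intro t ht
    have h1 := Real.integral_rpow_mul_exp_neg_mul_Ioi (a := α + 1) (r := -t) (by linarith)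
      (by linarith)
    have h2 : ∫ v in Set.Ioi (0 : ℝ), ((v ^ α : ℝ) : ℂ) * Complex.exp (t * v) =
        ((∫ v in Set.Ioi (0 : ℝ), v ^ (α + 1 - 1) * Real.exp (-(-t * v)) : ℝ) : ℂ) := by
      rw [← integral_complex_ofReal]
      refine integral_congr_ae (.of_forall fun v => ?_)
      simp
    rw [hmgf, h2, h1]
    have h3 : (0 : ℝ) ≤ 1 / -t := by
      have : 0 < -t := by linarith
      positivity
    push_cast [Complex.ofReal_cpow h3]
    ring
  have hEq := hana1.eqOn_of_preconnected_of_frequently_eq hana2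
    (convex_halfSpace_re_lt 0).isPreconnected (z₀ := ((-1 : ℝ) : ℂ)) (by simp) (by
      have h1 : ∃ᶠ t : ℝ in nhdsWithin (-1) {-1}ᶜ, ProbabilityTheory.complexMGF id μ t =
          (Real.Gamma (α + 1) : ℂ) * (1 / (-(t : ℂ))) ^ ((α : ℂ) + 1) := by
        refine Filter.Eventually.frequently ?_
        filter_upwards [mem_nhdsWithin_of_mem_nhds (Iio_mem_nhds (show (-1 : ℝ) < 0 by norm_num))]
          with t ht using hreal t ht
      have h2 : Filter.Tendsto (fun t : ℝ => (t : ℂ)) (nhdsWithin (-1) {-1}ᶜ)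
          (nhdsWithin ((-1 : ℝ) : ℂ) {((-1 : ℝ) : ℂ)}ᶜ) :=
        tendsto_nhdsWithin_of_tendsto_nhds_of_eventually_within _
          (Complex.continuous_ofReal.continuousAt.tendsto.mono_left nhdsWithin_le_nhds)
          (by filter_upwards [self_mem_nhdsWithin] with t ht using
            fun h => ht (Complex.ofReal_injective h))
      exact h2.frequently h1)
  have h := hEq (x := -s) (by simpa using hs)
  rw [hmgf] at h
  simpa using h

/-! ### Subordination of complex Gaussian multipliers to Bochner-Riesz means -/

/-- The integrand of the Bochner-Riesz mean without its multiplier, as a product. -/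
noncomputable def plainIntegrand {n k : ℕ} (f : Fin k → EuclideanSpace ℝ (Fin n) → ℂ)
    (x : EuclideanSpace ℝ (Fin n)) (ξ : Fin k → EuclideanSpace ℝ (Fin n)) : ℂ :=
  ∏ i, 𝓕 (f i) (ξ i) * Complex.exp (2 * Real.pi * Complex.I * ((inner ℝ x (ξ i) : ℝ) : ℂ))

lemma bochnerRieszMean_eq_integral_plainIntegrand {n k : ℕ} (α R : ℝ)
    (f : Fin k → EuclideanSpace ℝ (Fin n) → ℂ) (x : EuclideanSpace ℝ (Fin n)) :
    bochnerRieszMean α R f x =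
      ∫ ξ, (bochnerRieszMultiplier α (R⁻¹ • ξ) : ℂ) * plainIntegrand f x ξ := by
  unfold bochnerRieszMean plainIntegrand
  refine integral_congr_ae (.of_forall fun ξ => ?_)
  simp only [Finset.prod_mul_distrib, ← Complex.exp_sum, inner_sum, mul_assoc]
  congr 4
  push_cast
  simp only [Finset.mul_sum]

lemma integrable_plainIntegrand {n k : ℕ} (f : Fin k → SchwartzMap (EuclideanSpace ℝ (Fin n)) ℂ)
    (x : EuclideanSpace ℝ (Fin n)) :
    Integrable (plainIntegrand (fun i => (f i : EuclideanSpace ℝ (Fin n) → ℂ)) x) := by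
  unfold plainIntegrand
  refine Integrable.fintype_prod (f := fun i (ξ : EuclideanSpace ℝ (Fin n)) =>
    𝓕 (f i : EuclideanSpace ℝ (Fin n) → ℂ) ξ *
      Complex.exp (2 * Real.pi * Complex.I * ((inner ℝ x ξ : ℝ) : ℂ))) fun i => ?_
  have h1 : Integrable (𝓕 (f i : EuclideanSpace ℝ (Fin n) → ℂ)) := by
    rw [← SchwartzMap.fourier_coe]
    exact (𝓕 (f i)).integrable
  refine h1.mul_bdd (c := 1) (Continuous.aestronglyMeasurable (by fun_prop))
    (.of_forall fun ξ => ?_)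
  rw [show (2 * Real.pi * Complex.I * ((inner ℝ x ξ : ℝ) : ℂ)) =
    ((2 * Real.pi * inner ℝ x ξ : ℝ) : ℂ) * Complex.I by push_cast; ring,
    Complex.norm_exp_ofReal_mul_I]

/-- The kernel `(v - u)₊ ^ α`, which is `v ^ α` times the Bochner-Riesz multiplier of radius `√v`
at a frequency of squared length `u`. -/
noncomputable def truncatedPower (α u v : ℝ) : ℝ := if u < v then (v - u) ^ α else 0

lemma truncatedPower_nonneg (α u v : ℝ) : 0 ≤ truncatedPower α u v := by
  unfold truncatedPower
  split_ifs with h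
  · exact Real.rpow_nonneg (by linarith) _
  · rfl

lemma truncatedPower_le {α u v : ℝ} (hα : 0 ≤ α) (hu : 0 ≤ u) (hv : 0 ≤ v) :
    truncatedPower α u v ≤ v ^ α := by
  unfold truncatedPower
  split_ifs with h
  · exact Real.rpow_le_rpow (by linarith) (by linarith) hα
  · exact Real.rpow_nonneg hv _

lemma measurable_truncatedPower (α : ℝ) :
    Measurable (fun p : ℝ × ℝ => truncatedPower α p.1 p.2) := by
  unfold truncatedPower
  exact Measurable.ite (measurableSet_lt measurable_fst measurable_snd) (by fun_prop) (by fun_prop)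

lemma rpow_mul_bochnerRieszMultiplier {n k : ℕ} (α : ℝ) {v : ℝ} (hv : 0 < v)
    (ξ : Fin k → EuclideanSpace ℝ (Fin n)) :
    v ^ α * bochnerRieszMultiplier α ((Real.sqrt v)⁻¹ • ξ) =
      truncatedPower α (∑ i, ‖ξ i‖ ^ 2) v := by
  have h1 : ∑ i, ‖((Real.sqrt v)⁻¹ • ξ) i‖ ^ 2 = (∑ i, ‖ξ i‖ ^ 2) / v := by
    rw [Finset.sum_div]
    refine Finset.sum_congr rfl fun i _ => ?_
    rw [Pi.smul_apply, norm_smul, mul_pow, norm_inv, Real.norm_eq_abs, inv_pow, sq_abs,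
      Real.sq_sqrt hv.le]
    field_simp
  unfold bochnerRieszMultiplier truncatedPower
  simp only [h1, div_lt_one hv]
  split_ifs with h
  · rw [← Real.mul_rpow hv.le (by rw [sub_nonneg, div_le_one hv]; exact h.le)]
    congr 1
    field_simp
  · simp

lemma integral_truncatedPower_mul_cexp {α : ℝ} (hα : 0 ≤ α) {s : ℂ} (hs : 0 < s.re) {u : ℝ}
    (hu : 0 ≤ u) :
    ∫ v in Set.Ioi (0 : ℝ), (truncatedPower α u v : ℂ) * Complex.exp (-s * v) =
      (Real.Gamma (α + 1) : ℂ) * (1 / s) ^ ((α : ℂ) + 1) * Complex.exp (-s * u) := by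
  rw [← integral_rpow_mul_cexp_neg_mul hα hs]
  rw [← integral_indicator measurableSet_Ioi, ← integral_indicator measurableSet_Ioi,
    ← integral_mul_const]
  rw [← integral_add_right_eq_self _ u]
  refine integral_congr_ae (.of_forall fun v => ?_)
  simp only [Set.indicator_apply, Set.mem_Ioi, truncatedPower]
  by_cases hv : 0 < v
  · have h1 : 0 < v + u := by linarith
    have h2 : u < v + u := by linarith
    simp only [hv, h1, h2, if_true, add_sub_cancel_right]
    rw [mul_assoc, ← Complex.exp_add]
    congr 2
    push_cast
    ring
  · have h2 : ¬ u < v + u := by linarith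
    simp [hv, h2]

lemma integrableOn_rpow_mul_exp_neg {α : ℝ} (hα : 0 ≤ α) {σ : ℝ} (hσ : 0 < σ) :
    IntegrableOn (fun v : ℝ => v ^ α * Real.exp (-σ * v)) (Set.Ioi 0) := by
  have := integrableOn_rpow_mul_exp_neg_mul_rpow (s := α) (p := 1) (b := σ) (by linarith)
      one_pos hσ
  simpa using this

lemma norm_cexp_neg_mul_ofReal (s : ℂ) (v : ℝ) :
    ‖Complex.exp (-s * v)‖ = Real.exp (-s.re * v) := by
  rw [Complex.norm_exp]
  simp

/-- Joint integrability in the squared radius and the frequency, so that the two integrations may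
be exchanged. -/
lemma integrable_truncatedPower_mul_plainIntegrand {n k : ℕ} {α : ℝ} (hα : 0 ≤ α) {s : ℂ}
    (hs : 0 < s.re) (f : Fin k → SchwartzMap (EuclideanSpace ℝ (Fin n)) ℂ)
    (x : EuclideanSpace ℝ (Fin n)) :
    Integrable (Function.uncurry fun (v : ℝ) ξ =>
      (truncatedPower α (∑ i, ‖ξ i‖ ^ 2) v : ℂ) * Complex.exp (-s * v) *
        plainIntegrand (fun i => (f i : EuclideanSpace ℝ (Fin n) → ℂ)) x ξ)
      ((volume.restrict (Set.Ioi 0)).prod volume) := by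
  set G := plainIntegrand (fun i => (f i : EuclideanSpace ℝ (Fin n) → ℂ)) x with hG
  have hGint : Integrable G := integrable_plainIntegrand f x
  set U : (Fin k → EuclideanSpace ℝ (Fin n)) → ℝ := fun ξ => ∑ i, ‖ξ i‖ ^ 2 with hU
  have hUm : Measurable U := by fun_prop
  have hU0 : ∀ ξ, 0 ≤ U ξ := fun ξ => Finset.sum_nonneg fun i _ => by positivity
  have hdom := (integrableOn_rpow_mul_exp_neg hα hs).mul_prod hGint.norm
  refine hdom.mono ?_ ?_
  · refine AEStronglyMeasurable.mul ?_ hGint.aestronglyMeasurable.comp_snd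
    refine Measurable.aestronglyMeasurable ?_
    have h1 : Measurable (fun p : ℝ × (Fin k → EuclideanSpace ℝ (Fin n)) =>
        truncatedPower α (U p.2) p.1) :=
      (measurable_truncatedPower α).comp ((hUm.comp measurable_snd).prodMk measurable_fst)
    fun_prop
  · have h2 : ∀ᵐ p ∂((volume.restrict (Set.Ioi (0 : ℝ))).prod
        (volume : Measure (Fin k → EuclideanSpace ℝ (Fin n)))), p.1 ∈ Set.Ioi (0 : ℝ) :=
      Measure.quasiMeasurePreserving_fst.ae (ae_restrict_mem measurableSet_Ioi)
    filter_upwards [h2] with p hp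
    have hp' : 0 < p.1 := hp
    simp only [Function.uncurry, norm_mul, norm_cexp_neg_mul_ofReal, Complex.norm_real,
      Real.norm_eq_abs, Real.abs_exp, abs_of_nonneg (truncatedPower_nonneg _ _ _),
        abs_of_nonneg (Real.rpow_nonneg hp'.le α),
      abs_norm]
    gcongr
    exact truncatedPower_le hα (hU0 _) hp'.le

lemma rpow_mul_cexp_mul_bochnerRieszMean {n k : ℕ} (α : ℝ) (s : ℂ)
    (f : Fin k → EuclideanSpace ℝ (Fin n) → ℂ)
    (x : EuclideanSpace ℝ (Fin n)) {v : ℝ} (hv : 0 < v) :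
    ((v ^ α : ℝ) : ℂ) * Complex.exp (-s * v) * bochnerRieszMean α (Real.sqrt v) f x =
      ∫ ξ, (truncatedPower α (∑ i, ‖ξ i‖ ^ 2) v : ℂ) * Complex.exp (-s * v) *
        plainIntegrand f x ξ := by
  rw [bochnerRieszMean_eq_integral_plainIntegrand, ← integral_const_mul]
  refine integral_congr_ae (.of_forall fun ξ => ?_)
  simp only [← rpow_mul_bochnerRieszMultiplier α hv ξ]
  push_cast
  ring

lemma integrableOn_rpow_mul_cexp_mul_bochnerRieszMean {n k : ℕ} {α : ℝ} (hα : 0 ≤ α) {s : ℂ}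
    (hs : 0 < s.re) (f : Fin k → SchwartzMap (EuclideanSpace ℝ (Fin n)) ℂ)
    (x : EuclideanSpace ℝ (Fin n)) :
    IntegrableOn (fun v : ℝ => ((v ^ α : ℝ) : ℂ) * Complex.exp (-s * v) *
      bochnerRieszMean α (Real.sqrt v) (fun i => (f i : EuclideanSpace ℝ (Fin n) → ℂ)) x)
      (Set.Ioi 0) :=
  (integrable_truncatedPower_mul_plainIntegrand hα hs f x).integral_prod_left.congr
    (by filter_upwards [ae_restrict_mem measurableSet_Ioi] with v hv
        using (rpow_mul_cexp_mul_bochnerRieszMean α s _ x hv).symm)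

/-- The means of radius `√v`, averaged with weight `v ^ α exp (-s v)`, give the complex Gaussian
multiplier `exp (-s |ξ|²)`, which factorizes over the `k` functions. -/
lemma integral_rpow_mul_cexp_mul_bochnerRieszMean {n k : ℕ} {α : ℝ} (hα : 0 ≤ α) {s : ℂ}
    (hs : 0 < s.re) (f : Fin k → SchwartzMap (EuclideanSpace ℝ (Fin n)) ℂ)
    (x : EuclideanSpace ℝ (Fin n)) :
    ∫ v in Set.Ioi (0 : ℝ), ((v ^ α : ℝ) : ℂ) * Complex.exp (-s * v) *
      bochnerRieszMean α (Real.sqrt v) (fun i => (f i : EuclideanSpace ℝ (Fin n) → ℂ)) x =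
      (Real.Gamma (α + 1) : ℂ) * (1 / s) ^ ((α : ℂ) + 1) *
        ∏ i, ∫ ξ : EuclideanSpace ℝ (Fin n), Complex.exp (-s * (‖ξ‖ : ℂ) ^ 2) *
          (𝓕 (f i : EuclideanSpace ℝ (Fin n) → ℂ) ξ *
            Complex.exp (2 * Real.pi * Complex.I * ((inner ℝ x ξ : ℝ) : ℂ))) := by
  rw [setIntegral_congr_fun measurableSet_Ioi fun v hv =>
    rpow_mul_cexp_mul_bochnerRieszMean α s _ x hv,
    integral_integral_swap (integrable_truncatedPower_mul_plainIntegrand hα hs f x)]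
  rw [← integral_fintype_prod_volume_eq_prod (f := fun i (ξ : EuclideanSpace ℝ (Fin n)) =>
    Complex.exp (-s * (‖ξ‖ : ℂ) ^ 2) * (𝓕 (f i : EuclideanSpace ℝ (Fin n) → ℂ) ξ *
            Complex.exp (2 * Real.pi * Complex.I * ((inner ℝ x ξ : ℝ) : ℂ)))),
    ← integral_const_mul]
  refine integral_congr_ae (.of_forall fun ξ => ?_)
  simp only
  rw [integral_mul_const, integral_truncatedPower_mul_cexp hα hs
    (Finset.sum_nonneg fun i _ => by positivity),
    Finset.prod_mul_distrib, ← Complex.exp_sum, mul_assoc]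
  congr 2
  push_cast
  rw [Finset.mul_sum]

/-! ### Averages over a segment of the line `Re s = 1` -/

/-- An average of the factorized complex Gaussian multipliers over a segment of the line
`Re s = 1` is controlled by any bound `T` for the Bochner-Riesz means, times the `L¹` norm of the
Fourier transform of the weight. -/
lemma norm_integral_gaussian_evolution_le {n k : ℕ} {α : ℝ} (hα : 0 ≤ α)
    (f : Fin k → SchwartzMap (EuclideanSpace ℝ (Fin n)) ℂ) (x : EuclideanSpace ℝ (Fin n))
    {T : ℝ} (hT : ∀ R > 0,
      ‖bochnerRieszMean α R (fun i => (f i : EuclideanSpace ℝ (Fin n) → ℂ)) x‖ ≤ T)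
    {t : ℝ → ℝ} (ht : Continuous t) {W : ℝ → ℂ} (hW : Continuous W) {K : ℝ}
    (hK : ∀ v : ℝ, 0 < v → v ^ α * Real.exp (-v) ≤ K) {g : ℝ → ℝ} (hg : Integrable g)
    (hWg : ∀ v : ℝ, ‖∫ θ in (-1 : ℝ)..1, W θ * Complex.exp (-(t θ * v : ℝ) * Complex.I)‖ ≤ g v) :
    ‖∫ θ in (-1 : ℝ)..1, W θ * ((Real.Gamma (α + 1) : ℂ) *
        (1 / (1 + t θ * Complex.I)) ^ ((α : ℂ) + 1) *
        ∏ i, ∫ ξ : EuclideanSpace ℝ (Fin n),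
          Complex.exp (-(1 + t θ * Complex.I) * (‖ξ‖ : ℂ) ^ 2) *
          (𝓕 (f i : EuclideanSpace ℝ (Fin n) → ℂ) ξ *
            Complex.exp (2 * Real.pi * Complex.I * ((inner ℝ x ξ : ℝ) : ℂ))))‖ ≤
      T * K * ∫ v, g v := by
  have hs : ∀ θ, 0 < (1 + t θ * Complex.I).re := fun θ => by simp
  set B : ℝ → ℂ := fun v =>
    bochnerRieszMean α (Real.sqrt v) (fun i => (f i : EuclideanSpace ℝ (Fin n) → ℂ)) x with hB
  set Φ : ℝ → ℂ := fun v => ((v ^ α : ℝ) : ℂ) * Complex.exp (-(1 : ℂ) * v) * B v with hΦ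
  have hΦint : Integrable Φ (volume.restrict (Set.Ioi 0)) :=
    integrableOn_rpow_mul_cexp_mul_bochnerRieszMean hα (by simp) f x
  have hg0 : ∀ v, 0 ≤ g v := fun v => (norm_nonneg _).trans (hWg v)
  have hT0 : 0 ≤ T := (norm_nonneg _).trans (hT 1 one_pos)
  have hK0 : 0 ≤ K := le_trans (by positivity) (hK 1 one_pos)
  have hΦle : ∀ v : ℝ, 0 < v → ‖Φ v‖ ≤ T * K := by
    intro v hv
    have hexp : ‖Complex.exp (-(1 : ℂ) * v)‖ = Real.exp (-v) := by
      rw [norm_cexp_neg_mul_ofReal, Complex.one_re, neg_one_mul]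
    rw [hΦ, norm_mul, norm_mul, hexp, Complex.norm_real, Real.norm_eq_abs,
      abs_of_nonneg (Real.rpow_nonneg hv.le α), mul_comm T K]
    exact mul_le_mul (hK v hv) (hT _ (Real.sqrt_pos.2 hv)) (norm_nonneg _) hK0
  have hjoint : Integrable (Function.uncurry fun θ v =>
      W θ * Complex.exp (-(t θ * v : ℝ) * Complex.I) * Φ v)
      ((volume.restrict (Set.Ioc (-1 : ℝ) 1)).prod (volume.restrict (Set.Ioi 0))) := by
    have hWint : Integrable W (volume.restrict (Set.Ioc (-1 : ℝ) 1)) :=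
      (hW.integrableOn_Icc).mono_set Set.Ioc_subset_Icc_self
    have h1 := hWint.mul_prod hΦint
    have h2 := h1.bdd_mul (c := 1)
      (f := fun p : ℝ × ℝ => Complex.exp (-(t p.1 * p.2 : ℝ) * Complex.I))
      (Continuous.aestronglyMeasurable (by fun_prop)) (.of_forall fun p => by
        rw [← Complex.ofReal_neg, Complex.norm_exp_ofReal_mul_I])
    refine h2.congr (.of_forall fun p => ?_)
    simp only [Function.uncurry]
    ring
  have hswap : ∫ θ in (-1 : ℝ)..1, W θ * ((Real.Gamma (α + 1) : ℂ) *
        (1 / (1 + t θ * Complex.I)) ^ ((α : ℂ) + 1) *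
        ∏ i, ∫ ξ : EuclideanSpace ℝ (Fin n),
          Complex.exp (-(1 + t θ * Complex.I) * (‖ξ‖ : ℂ) ^ 2) *
          (𝓕 (f i : EuclideanSpace ℝ (Fin n) → ℂ) ξ *
            Complex.exp (2 * Real.pi * Complex.I * ((inner ℝ x ξ : ℝ) : ℂ)))) =
      ∫ v in Set.Ioi (0 : ℝ),
        (∫ θ in (-1 : ℝ)..1, W θ * Complex.exp (-(t θ * v : ℝ) * Complex.I)) * Φ v := by
    simp_rw [intervalIntegral.integral_of_le (show (-1 : ℝ) ≤ 1 by norm_num),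
      ← integral_mul_const]
    rw [← integral_integral_swap hjoint]
    refine integral_congr_ae (.of_forall fun θ => ?_)
    simp only
    rw [← integral_rpow_mul_cexp_mul_bochnerRieszMean hα (hs θ) f x, ← integral_const_mul]
    refine integral_congr_ae (.of_forall fun v => ?_)
    simp only [hΦ, hB]
    have h3 : Complex.exp (-(1 + t θ * Complex.I) * v) =
        Complex.exp (-(t θ * v : ℝ) * Complex.I) * Complex.exp (-(1 : ℂ) * v) := by
      rw [← Complex.exp_add]
      congr 1
      push_cast
      ring
    rw [h3]
    ring
  rw [hswap]
  calc ‖∫ v in Set.Ioi (0 : ℝ),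
        (∫ θ in (-1 : ℝ)..1, W θ * Complex.exp (-(t θ * v : ℝ) * Complex.I)) * Φ v‖
      ≤ ∫ v in Set.Ioi (0 : ℝ), g v * (T * K) := by
        refine norm_integral_le_of_norm_le (hg.integrableOn.mul_const _) ?_
        filter_upwards [ae_restrict_mem measurableSet_Ioi] with v hv
        rw [norm_mul]
        exact mul_le_mul (hWg v) (hΦle v hv) (norm_nonneg _) (hg0 v)
    _ ≤ ∫ v, g v * (T * K) :=
        setIntegral_le_integral (hg.mul_const _) (.of_forall fun v => by
          have := hg0 v
          positivity)
    _ = _ := by rw [integral_mul_const]; ring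

/-- Decay of the Fourier transform of a function vanishing to first order at both end points,
by two integrations by parts. -/
lemma norm_integral_mul_cexp_le {W W' W'' : ℝ → ℂ} (h1 : ∀ θ, HasDerivAt W (W' θ) θ)
    (h2 : ∀ θ, HasDerivAt W' (W'' θ) θ) (hc : Continuous W'')
    (hW1 : W 1 = 0) (hWm1 : W (-1) = 0) (hW'1 : W' 1 = 0) (hW'm1 : W' (-1) = 0) {M : ℝ}
    (hM : ∀ θ ∈ Set.Icc (-1 : ℝ) 1, ‖W θ‖ ≤ M) (hM'' : ∀ θ ∈ Set.Icc (-1 : ℝ) 1, ‖W'' θ‖ ≤ M)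
    (y : ℝ) :
    ‖∫ θ in (-1 : ℝ)..1, W θ * Complex.exp (-(y * θ : ℝ) * Complex.I)‖ ≤
      4 * M * (1 + y ^ 2)⁻¹ := by
  set e : ℝ → ℂ := fun θ => Complex.exp (-(y * θ : ℝ) * Complex.I) with he
  have hed : ∀ θ, HasDerivAt e (-(y : ℂ) * Complex.I * e θ) θ := by
    intro θ
    have h3 : HasDerivAt (fun θ : ℝ => -((y * θ : ℝ) : ℂ) * Complex.I) (-(y : ℂ) * Complex.I) θ := by
      have := ((hasDerivAt_id θ).const_mul y).ofReal_comp.neg.mul_const Complex.I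
      simpa using this
    have := h3.cexp
    simpa [he, mul_comm] using this
  have hen : ∀ θ, ‖e θ‖ = 1 := fun θ => by
    rw [he]
    simp only
    rw [← Complex.ofReal_neg, Complex.norm_exp_ofReal_mul_I]
  have hec : Continuous e := by fun_prop
  have hWc : Continuous W := continuous_iff_continuousAt.2 fun θ => (h1 θ).continuousAt
  have hW'c : Continuous W' := continuous_iff_continuousAt.2 fun θ => (h2 θ).continuousAt
  have hbound : ∀ F : ℝ → ℂ, (∀ θ ∈ Set.Icc (-1 : ℝ) 1, ‖F θ‖ ≤ M) →
      ‖∫ θ in (-1 : ℝ)..1, F θ * e θ‖ ≤ 2 * M := by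
    intro F hF
    have := intervalIntegral.norm_integral_le_of_norm_le_const (a := (-1 : ℝ)) (b := 1) (C := M)
      (f := fun θ => F θ * e θ) (fun θ hθ => by
        rw [norm_mul, hen, mul_one]
        rw [Set.uIoc_of_le (by norm_num)] at hθ
        exact hF θ ⟨hθ.1.le, hθ.2⟩)
    rw [show |(1 : ℝ) - -1| = 2 by norm_num] at this
    linarith
  -- Each integration by parts trades a derivative of the weight for a factor `i y`.
  have hparts : ∀ F F' : ℝ → ℂ, (∀ θ, HasDerivAt F (F' θ) θ) → Continuous F' → Continuous F →
      F 1 = 0 → F (-1) = 0 → ∫ θ in (-1 : ℝ)..1, F' θ * e θ =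
        (y : ℂ) * Complex.I * ∫ θ in (-1 : ℝ)..1, F θ * e θ := by
    intro F F' hF hF'c hFc hF1 hFm1
    have h4 := intervalIntegral.integral_deriv_mul_eq_sub (a := (-1 : ℝ)) (b := 1) (u := F) (v := e)
      (u' := F') (v' := fun θ => -(y : ℂ) * Complex.I * e θ) (fun θ _ => hF θ) (fun θ _ => hed θ)
      (hF'c.intervalIntegrable _ _) (Continuous.intervalIntegrable (by fun_prop) _ _)
    rw [intervalIntegral.integral_add (Continuous.intervalIntegrable (by fun_prop) _ _)
      (Continuous.intervalIntegrable (by fun_prop) _ _), hF1, hFm1, zero_mul, zero_mul,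
      sub_zero] at h4
    have h5 : ∫ θ in (-1 : ℝ)..1, F θ * (-(y : ℂ) * Complex.I * e θ) =
        -((y : ℂ) * Complex.I * ∫ θ in (-1 : ℝ)..1, F θ * e θ) := by
      rw [← intervalIntegral.integral_const_mul, ← intervalIntegral.integral_neg]
      congr 1
      funext θ
      ring
    rw [h5] at h4
    linear_combination h4
  have h6 : ∫ θ in (-1 : ℝ)..1, W'' θ * e θ =
      -(y : ℂ) ^ 2 * ∫ θ in (-1 : ℝ)..1, W θ * e θ := by
    rw [hparts W' W'' h2 hc hW'c hW'1 hW'm1, hparts W W' h1 hW'c hWc hW1 hWm1]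
    linear_combination (y : ℂ) ^ 2 * (∫ θ in (-1 : ℝ)..1, W θ * e θ) * Complex.I_sq
  have h7 := hbound W hM
  have h8 := hbound W'' hM''
  rw [h6, norm_mul, norm_neg, norm_pow, Complex.norm_real, Real.norm_eq_abs, sq_abs] at h8
  rw [← div_eq_mul_inv, le_div_iff₀ (by positivity)]
  linarith

/-! ### The smooth window in time -/

/-- Along the line `Re s = 1`, the power `s ^ β` cut off by the window `(1 - θ²)²`, with `s` running
through a segment of half-length `δ` centred at `1 + iτ`. -/
noncomputable def windowedPower (β τ δ θ : ℝ) : ℂ :=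
  (1 - (θ : ℂ) ^ 2) ^ 2 * (1 + ((τ + δ * θ : ℝ) : ℂ) * Complex.I) ^ (β : ℂ)

lemma hasDerivAt_line_cpow (β τ δ θ : ℝ) :
    HasDerivAt (fun θ : ℝ => (1 + ((τ + δ * θ : ℝ) : ℂ) * Complex.I) ^ (β : ℂ))
      ((β : ℂ) * (1 + ((τ + δ * θ : ℝ) : ℂ) * Complex.I) ^ ((β - 1 : ℝ) : ℂ) *
        ((δ : ℂ) * Complex.I)) θ := by
  have h1 : HasDerivAt (fun θ : ℝ => (1 + ((τ + δ * θ : ℝ) : ℂ) * Complex.I))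
      ((δ : ℂ) * Complex.I) θ := by
    have h2 : HasDerivAt (fun θ : ℝ => τ + δ * θ) δ θ := by
      simpa using ((hasDerivAt_id θ).const_mul δ).const_add τ
    simpa using (h2.ofReal_comp.mul_const Complex.I).const_add 1
  have h3 : (1 + ((τ + δ * θ : ℝ) : ℂ) * Complex.I) ∈ Complex.slitPlane := by
    left
    simp
  have h4 := (hasDerivAt_id (1 + ((τ + δ * θ : ℝ) : ℂ) * Complex.I)).cpow_const (c := (β : ℂ))
    (by simpa using h3)
  have h5 := h4.comp_of_eq θ h1 rfl
  simp only [id, mul_one] at h5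
  push_cast
  push_cast at h5
  exact h5

lemma norm_line_cpow_le {β τ δ : ℝ} (hδ : 0 < δ) (h1 : δ ≤ τ - δ) {θ : ℝ}
    (hθ : θ ∈ Set.Icc (-1 : ℝ) 1) :
    ‖(1 + ((τ + δ * θ : ℝ) : ℂ) * Complex.I) ^ ((β - 1 : ℝ) : ℂ)‖ * δ ≤
      ‖(1 + ((τ + δ * θ : ℝ) : ℂ) * Complex.I) ^ (β : ℂ)‖ := by
  set s : ℂ := 1 + ((τ + δ * θ : ℝ) : ℂ) * Complex.I with hs
  have h2 : δ ≤ ‖s‖ := by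
    have h3 : s.im = τ + δ * θ := by simp [hs]
    have h4 : δ ≤ s.im := by rw [h3]; nlinarith [hθ.1]
    exact h4.trans ((le_abs_self _).trans (Complex.abs_im_le_norm s))
  have h5 : 0 < ‖s‖ := hδ.trans_le h2
  rw [Complex.norm_cpow_real, Complex.norm_cpow_real, Real.rpow_sub_one h5.ne']
  have := Real.rpow_pos_of_pos h5 β
  rw [div_mul_eq_mul_div, div_le_iff₀ h5]
  gcongr

lemma norm_integral_windowedPower_mul_cexp_le {β τ δ L : ℝ} (hβ : 1 ≤ β) (hδ : 0 < δ)
    (h1 : δ ≤ τ - δ) (hL : 1 + (τ + δ) ≤ L) (y : ℝ) :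
    ‖∫ θ in (-1 : ℝ)..1, windowedPower β τ δ θ * Complex.exp (-(y * θ : ℝ) * Complex.I)‖ ≤
      4 * ((8 + 8 * β + β ^ 2) * L ^ β) * (1 + y ^ 2)⁻¹ := by
  set S : ℝ → ℝ → ℂ := fun γ θ => (1 + ((τ + δ * θ : ℝ) : ℂ) * Complex.I) ^ (γ : ℂ) with hS
  set D : ℂ := (δ : ℂ) * Complex.I with hD
  have hSd : ∀ γ θ, HasDerivAt (S γ) (γ * S (γ - 1) θ * D) θ := fun γ θ =>
    hasDerivAt_line_cpow γ τ δ θ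
  have hSc : ∀ γ, Continuous (S γ) := fun γ =>
    continuous_iff_continuousAt.2 fun θ => (hSd γ θ).continuousAt
  have hid : ∀ θ : ℝ, HasDerivAt (fun θ : ℝ => (θ : ℂ)) 1 θ := fun θ => by
    simpa using (hasDerivAt_id θ).ofReal_comp
  have hb : ∀ θ : ℝ, HasDerivAt (fun θ : ℝ => (1 - (θ : ℂ) ^ 2) ^ 2)
      (-4 * θ * (1 - (θ : ℂ) ^ 2)) θ := fun θ => by
    refine ((((hid θ).pow 2).const_sub 1).pow 2).congr_deriv ?_
    simp only [Pi.pow_apply]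
    push_cast
    ring
  have hb' : ∀ θ : ℝ, HasDerivAt (fun θ : ℝ => -4 * (θ : ℂ) * (1 - (θ : ℂ) ^ 2))
      (-4 + 12 * (θ : ℂ) ^ 2) θ := fun θ => by
    refine (((hid θ).const_mul (-4)).mul (((hid θ).pow 2).const_sub 1)).congr_deriv ?_
    simp only [Pi.pow_apply]
    push_cast
    ring
  have hSβ : ∀ θ ∈ Set.Icc (-1 : ℝ) 1, ‖S β θ‖ ≤ L ^ β := by
    intro θ hθ
    rw [hS]
    simp only
    rw [Complex.norm_cpow_real]
    refine Real.rpow_le_rpow (norm_nonneg _) ?_ (by linarith)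
    refine (norm_add_le _ _).trans ?_
    have h2 : 0 ≤ τ + δ * θ := by nlinarith [hθ.1]
    rw [norm_one, norm_mul, Complex.norm_I, mul_one, Complex.norm_real, Real.norm_eq_abs,
      abs_of_nonneg h2]
    nlinarith [hθ.2]
  have hS1 : ∀ θ ∈ Set.Icc (-1 : ℝ) 1, ‖S (β - 1) θ‖ * δ ≤ L ^ β := fun θ hθ =>
    (norm_line_cpow_le hδ h1 hθ).trans (hSβ θ hθ)
  have hS2 : ∀ θ ∈ Set.Icc (-1 : ℝ) 1, ‖S (β - 1 - 1) θ‖ * δ * δ ≤ L ^ β := fun θ hθ =>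
    (mul_le_mul_of_nonneg_right (norm_line_cpow_le hδ h1 hθ) hδ.le).trans (hS1 θ hθ)
  have hDn : ‖D‖ = δ := by
    rw [hD, norm_mul, Complex.norm_I, mul_one, Complex.norm_real, Real.norm_eq_abs,
      abs_of_pos hδ]
  have hsq : ∀ θ ∈ Set.Icc (-1 : ℝ) 1, θ ^ 2 ≤ 1 := fun θ hθ => by nlinarith [hθ.1, hθ.2]
  have hbn : ∀ θ ∈ Set.Icc (-1 : ℝ) 1, ‖(1 - (θ : ℂ) ^ 2)‖ ≤ 1 := by
    intro θ hθ
    rw [show (1 - (θ : ℂ) ^ 2) = ((1 - θ ^ 2 : ℝ) : ℂ) by push_cast; ring, Complex.norm_real,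
      Real.norm_eq_abs, abs_of_nonneg (by linarith [hsq θ hθ])]
    nlinarith [sq_nonneg θ]
  have hb1n : ∀ θ ∈ Set.Icc (-1 : ℝ) 1, ‖-4 * (θ : ℂ) * (1 - (θ : ℂ) ^ 2)‖ ≤ 4 := by
    intro θ hθ
    rw [norm_mul, norm_mul, norm_neg, Complex.norm_real, Real.norm_eq_abs]
    have h2 : |θ| ≤ 1 := abs_le.2 hθ
    have h3 := hbn θ hθ
    have : ‖(4 : ℂ)‖ = 4 := by simp
    rw [this]
    nlinarith [norm_nonneg (1 - (θ : ℂ) ^ 2), abs_nonneg θ,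
      mul_le_mul h2 h3 (norm_nonneg _) zero_le_one]
  have hb2n : ∀ θ ∈ Set.Icc (-1 : ℝ) 1, ‖-4 + 12 * (θ : ℂ) ^ 2‖ ≤ 8 := by
    intro θ hθ
    rw [show (-4 + 12 * (θ : ℂ) ^ 2) = ((-4 + 12 * θ ^ 2 : ℝ) : ℂ) by push_cast; ring,
      Complex.norm_real, Real.norm_eq_abs, abs_le]
    constructor <;> nlinarith [hsq θ hθ, sq_nonneg θ]
  have hL0 : 0 ≤ L ^ β := (norm_nonneg _).trans (hSβ 0 (by norm_num))
  have hβ1 : ‖((β - 1 : ℝ) : ℂ)‖ ≤ β := by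
    rw [Complex.norm_real, Real.norm_eq_abs, abs_of_nonneg (by linarith)]
    linarith
  have hβ0 : ‖(β : ℂ)‖ = β := by
    rw [Complex.norm_real, Real.norm_eq_abs, abs_of_nonneg (by linarith)]
  refine norm_integral_mul_cexp_le (W := windowedPower β τ δ)
    (W' := fun θ => -4 * θ * (1 - (θ : ℂ) ^ 2) * S β θ +
      (1 - (θ : ℂ) ^ 2) ^ 2 * (β * S (β - 1) θ * D))
    (W'' := fun θ => ((-4 + 12 * (θ : ℂ) ^ 2) * S β θ +
      -4 * θ * (1 - (θ : ℂ) ^ 2) * (β * S (β - 1) θ * D)) +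
      (-4 * θ * (1 - (θ : ℂ) ^ 2) * (β * S (β - 1) θ * D) + (1 - (θ : ℂ) ^ 2) ^ 2 *
        (β * (((β - 1 : ℝ) : ℂ) * S (β - 1 - 1) θ * D) * D)))
    (fun θ => (hb θ).mul (hSd β θ))
    (fun θ => ((hb' θ).mul (hSd β θ)).add
      ((hb θ).mul (((hSd (β - 1) θ).const_mul (β : ℂ)).mul_const D)))
    ?_ (by simp [windowedPower]) (by simp [windowedPower]) (by simp) (by simp) ?_ ?_ y
  · have := hSc β
    have := hSc (β - 1)
    have := hSc (β - 1 - 1)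
    fun_prop
  · intro θ hθ
    have h2 : ‖windowedPower β τ δ θ‖ ≤ 1 ^ 2 * L ^ β := by
      rw [windowedPower, norm_mul, norm_pow]
      exact mul_le_mul (pow_le_pow_left₀ (norm_nonneg _) (hbn θ hθ) 2) (hSβ θ hθ) (norm_nonneg _)
        (by norm_num)
    nlinarith
  · intro θ hθ
    have e1 : ‖(-4 + 12 * (θ : ℂ) ^ 2) * S β θ‖ ≤ 8 * L ^ β := by
      rw [norm_mul]
      exact mul_le_mul (hb2n θ hθ) (hSβ θ hθ) (norm_nonneg _) (by norm_num)
    have e2 : ‖-4 * θ * (1 - (θ : ℂ) ^ 2) * (β * S (β - 1) θ * D)‖ ≤ 4 * (β * L ^ β) := by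
      rw [norm_mul]
      refine mul_le_mul (hb1n θ hθ) ?_ (norm_nonneg _) (by norm_num)
      rw [norm_mul, norm_mul, hDn, hβ0, mul_assoc]
      exact mul_le_mul_of_nonneg_left (hS1 θ hθ) (by linarith)
    have e3 : ‖(1 - (θ : ℂ) ^ 2) ^ 2 *
        (β * (((β - 1 : ℝ) : ℂ) * S (β - 1 - 1) θ * D) * D)‖ ≤ 1 ^ 2 * (β * (β * L ^ β)) := by
      rw [norm_mul, norm_pow]
      refine mul_le_mul (pow_le_pow_left₀ (norm_nonneg _) (hbn θ hθ) 2) ?_ (norm_nonneg _)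
        (by norm_num)
      rw [norm_mul, norm_mul, norm_mul, norm_mul, hDn, hβ0, mul_assoc, mul_assoc, mul_assoc]
      refine mul_le_mul_of_nonneg_left ?_ (by linarith)
      refine mul_le_mul hβ1 ?_ (by positivity) (by linarith)
      rw [← mul_assoc]
      exact hS2 θ hθ
    refine (norm_add_le _ _).trans ?_
    have e4 := norm_add_le ((-4 + 12 * (θ : ℂ) ^ 2) * S β θ)
      (-4 * θ * (1 - (θ : ℂ) ^ 2) * (β * S (β - 1) θ * D))
    have e5 := norm_add_le (-4 * θ * (1 - (θ : ℂ) ^ 2) * (β * S (β - 1) θ * D))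
      ((1 - (θ : ℂ) ^ 2) ^ 2 * (β * (((β - 1 : ℝ) : ℂ) * S (β - 1 - 1) θ * D) * D))
    nlinarith

lemma integrable_inv_one_add_sq_affine {δ : ℝ} (hδ : 0 < δ) (m : ℝ) :
    Integrable (fun v : ℝ => (1 + (δ * (v + m)) ^ 2)⁻¹) :=
  (integrable_inv_one_add_sq.comp_mul_left' hδ.ne').comp_add_right m

lemma integral_inv_one_add_sq_affine {δ : ℝ} (hδ : 0 < δ) (m : ℝ) :
    ∫ v : ℝ, (1 + (δ * (v + m)) ^ 2)⁻¹ = Real.pi / δ := by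
  rw [integral_add_right_eq_self (fun v : ℝ => (1 + (δ * v) ^ 2)⁻¹) m,
    Measure.integral_comp_mul_left (fun v : ℝ => (1 + v ^ 2)⁻¹) δ, integral_univ_inv_one_add_sq,
    abs_of_pos (inv_pos.2 hδ), smul_eq_mul]
  field_simp

/-- A window of the factorized evolution, modulated by an arbitrary frequency `m`, bounds the
Bochner-Riesz means from below. -/
lemma norm_integral_window_evolution_le {n k : ℕ} {α : ℝ} (hα : 0 ≤ α)
    (f : Fin k → SchwartzMap (EuclideanSpace ℝ (Fin n)) ℂ) (x : EuclideanSpace ℝ (Fin n))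
    {T : ℝ} (hT : ∀ R > 0,
      ‖bochnerRieszMean α R (fun i => (f i : EuclideanSpace ℝ (Fin n) → ℂ)) x‖ ≤ T)
    {K : ℝ} (hK : ∀ v : ℝ, 0 < v → v ^ α * Real.exp (-v) ≤ K)
    {τ δ L : ℝ} (hδ : 0 < δ) (h1 : δ ≤ τ - δ) (hL : 1 + (τ + δ) ≤ L) (m : ℝ) :
    Real.Gamma (α + 1) * ‖∫ θ in (-1 : ℝ)..1, (1 - (θ : ℂ) ^ 2) ^ 2 *
      Complex.exp (-(m * (δ * θ) : ℝ) * Complex.I) *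
        ∏ i, ∫ ξ : EuclideanSpace ℝ (Fin n),
          Complex.exp (-(1 + ((τ + δ * θ : ℝ) : ℂ) * Complex.I) * (‖ξ‖ : ℂ) ^ 2) *
          (𝓕 (f i : EuclideanSpace ℝ (Fin n) → ℂ) ξ *
            Complex.exp (2 * Real.pi * Complex.I * ((inner ℝ x ξ : ℝ) : ℂ)))‖ ≤
      T * K * (4 * ((8 + 8 * (α + 1) + (α + 1) ^ 2) * L ^ (α + 1)) * (Real.pi / δ)) := by
  have hΓ : 0 < Real.Gamma (α + 1) := Real.Gamma_pos_of_pos (by linarith)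
  have hcont : Continuous (windowedPower (α + 1) τ δ) := by
    unfold windowedPower
    refine Continuous.mul (by fun_prop) ?_
    exact continuous_iff_continuousAt.2 fun θ => (hasDerivAt_line_cpow _ τ δ θ).continuousAt
  have h := norm_integral_gaussian_evolution_le hα f x hT (t := fun θ => τ + δ * θ) (by fun_prop)
    (W := fun θ => windowedPower (α + 1) τ δ θ * Complex.exp (-(m * (δ * θ) : ℝ) * Complex.I))
    (by fun_prop) hK
    (g := fun v => 4 * ((8 + 8 * (α + 1) + (α + 1) ^ 2) * L ^ (α + 1)) *
      (1 + (δ * (v + m)) ^ 2)⁻¹) ((integrable_inv_one_add_sq_affine hδ m).const_mul _) (fun v => by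
        refine le_trans (le_of_eq ?_) (norm_integral_windowedPower_mul_cexp_le
          (show 1 ≤ α + 1 by linarith) hδ h1 hL (δ * (v + m)))
        -- The phase `exp (-iτv)` at the centre of the window does not depend on `θ`.
        have h5 : ∀ θ : ℝ, windowedPower (α + 1) τ δ θ *
            Complex.exp (-(m * (δ * θ) : ℝ) * Complex.I) *
            Complex.exp (-((τ + δ * θ) * v : ℝ) * Complex.I) =
            Complex.exp ((-(τ * v) : ℝ) * Complex.I) * (windowedPower (α + 1) τ δ θ *
              Complex.exp (-(δ * (v + m) * θ : ℝ) * Complex.I)) := fun θ => by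
          rw [mul_assoc, ← Complex.exp_add, mul_left_comm (Complex.exp _), ← Complex.exp_add]
          congr 2
          push_cast
          ring
        simp only [h5]
        rw [intervalIntegral.integral_const_mul, norm_mul, Complex.norm_exp_ofReal_mul_I, one_mul])
  rw [integral_const_mul, integral_inv_one_add_sq_affine hδ] at h
  refine le_trans (le_of_eq ?_) h
  have hΓn : Real.Gamma (α + 1) = ‖(Real.Gamma (α + 1) : ℂ)‖ := by
    rw [Complex.norm_real, Real.norm_eq_abs, abs_of_pos hΓ]
  nth_rewrite 1 [hΓn]
  rw [← norm_mul, ← intervalIntegral.integral_const_mul]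
  congr 2
  funext θ
  have h2 : (1 + ((τ + δ * θ : ℝ) : ℂ) * Complex.I) ≠ 0 := fun h => by
    simpa using congrArg Complex.re h
  have h3 : (1 + ((τ + δ * θ : ℝ) : ℂ) * Complex.I).arg ≠ Real.pi := by
    rw [Ne, Complex.arg_eq_pi_iff]
    intro h
    have := h.1
    simp at this
    linarith
  have h4 : (1 + ((τ + δ * θ : ℝ) : ℂ) * Complex.I) ^ ((α + 1 : ℝ) : ℂ) *
      (1 / (1 + ((τ + δ * θ : ℝ) : ℂ) * Complex.I)) ^ ((α : ℂ) + 1) = 1 := by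
    rw [one_div, Complex.inv_cpow _ _ h3]
    push_cast
    push_cast at h2
    rw [mul_inv_cancel₀]
    rw [Ne, Complex.cpow_eq_zero_iff]
    tauto
  unfold windowedPower
  linear_combination (exp := 1) (-1 : ℂ) * (Real.Gamma (α + 1) : ℂ) * (1 - (θ : ℂ) ^ 2) ^ 2 *
      Complex.exp (-(m * (δ * θ) : ℝ) * Complex.I) *
        (∏ i, ∫ ξ : EuclideanSpace ℝ (Fin n),
          Complex.exp (-(1 + ((τ + δ * θ : ℝ) : ℂ) * Complex.I) * (‖ξ‖ : ℂ) ^ 2) *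
          (𝓕 (f i : EuclideanSpace ℝ (Fin n) → ℂ) ξ *
            Complex.exp (2 * Real.pi * Complex.I * ((inner ℝ x ξ : ℝ) : ℂ)))) * h4

/-! ### Evolution of a one-dimensional Gaussian -/

/-- One coordinate of the evolved Gaussian at time `t`: with `s = 1 + it`, the one-dimensional
integral of `exp (-s ξ²)` against the Fourier transform of a Gaussian of parameter `a` and frequency
`c`, at the point `X / π`. -/
noncomputable def evolvedGaussian (a c X t : ℝ) : ℂ :=
  (Real.sqrt (a / Real.pi) : ℂ) * ((Real.pi / (a + (1 + t * Complex.I))) ^ (1 / 2 : ℂ) *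
    Complex.exp (-(a : ℂ) * c ^ 2 +
      (a * c + X * Complex.I) ^ 2 / (a + (1 + t * Complex.I))))

lemma pi_div_re_pos {w : ℂ} (hw : 0 < w.re) : 0 < (Real.pi / w : ℂ).re := by
  have h1 : (Real.pi / w : ℂ).re = Real.pi * (w.re / Complex.normSq w) := by
    rw [div_eq_mul_inv, Complex.re_ofReal_mul, Complex.inv_re]
  have h2 : 0 < Complex.normSq w := Complex.normSq_pos.2 fun h => by simp [h] at hw
  have := Real.pi_pos
  rw [h1]
  positivity

lemma continuous_evolvedGaussian {a : ℝ} (ha : 0 < a) (c X : ℝ) :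
    Continuous (evolvedGaussian a c X) := by
  have hre : ∀ t : ℝ, 0 < ((a : ℂ) + (1 + t * Complex.I)).re := fun t => by simp; positivity
  have hne : ∀ t : ℝ, (a : ℂ) + (1 + t * Complex.I) ≠ 0 := fun t h => by
    have := hre t
    simp [h] at this
  unfold evolvedGaussian
  refine continuous_const.mul (Continuous.mul ?_ ?_)
  · refine Continuous.cpow ?_ continuous_const fun t => Or.inl (pi_div_re_pos (hre t))
    exact continuous_const.div (by fun_prop) hne
  · refine Complex.continuous_exp.comp (continuous_const.add ?_)
    exact continuous_const.div (by fun_prop) hne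

lemma norm_log_pi_div_sub_le {a N τ h : ℝ} (ha : 0 < a) (hN : 0 < N) (hτ : N ≤ τ)
    (hh : N / 2 ≤ τ + h) :
    ‖Complex.log (Real.pi / (a + (1 + ((τ + h : ℝ) : ℂ) * Complex.I))) -
      Complex.log (Real.pi / (a + (1 + τ * Complex.I)))‖ ≤ 2 / N * |h| := by
  have hre : ∀ t : ℝ, 0 < ((a : ℂ) + (1 + t * Complex.I)).re := fun t => by simp; positivity
  have hne : ∀ t : ℝ, (a : ℂ) + (1 + t * Complex.I) ≠ 0 := fun t h => by
    have := hre t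
    simp [h] at this
  have hpi : (Real.pi : ℂ) ≠ 0 := by exact_mod_cast Real.pi_ne_zero
  have hd : ∀ t ∈ Set.Ici (N / 2), HasDerivWithinAt
      (fun t : ℝ => Complex.log (Real.pi / (a + (1 + t * Complex.I))))
      (-Complex.I / (a + (1 + t * Complex.I))) (Set.Ici (N / 2)) t := by
    intro t _
    have h1 : HasDerivAt (fun t : ℝ => (a : ℂ) + (1 + t * Complex.I)) Complex.I t := by
      simpa using
        ((((hasDerivAt_id t).ofReal_comp).mul_const Complex.I).const_add 1).const_add (a : ℂ)
    have h2 := ((h1.inv (hne t)).const_mul (Real.pi : ℂ)).clog_real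
      (Or.inl (by simpa [div_eq_mul_inv] using pi_div_re_pos (hre t)))
    have h3 : (Real.pi : ℂ) * (-Complex.I / (a + (1 + t * Complex.I)) ^ 2) /
        ((Real.pi : ℂ) * (a + (1 + t * Complex.I))⁻¹) = -Complex.I / (a + (1 + t * Complex.I)) := by
      have := hne t
      field_simp
    exact (h2.congr_deriv h3).hasDerivWithinAt
  have hb : ∀ t ∈ Set.Ici (N / 2), ‖-Complex.I / ((a : ℂ) + (1 + t * Complex.I))‖ ≤ 2 / N := by
    intro t ht
    have ht' : N / 2 ≤ t := ht
    have h1 : N / 2 ≤ ‖(a : ℂ) + (1 + t * Complex.I)‖ := by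
      refine le_trans ?_ (Complex.abs_im_le_norm _)
      have : ((a : ℂ) + (1 + t * Complex.I)).im = t := by simp
      rw [this]
      exact ht'.trans (le_abs_self _)
    rw [norm_div, norm_neg, Complex.norm_I, div_le_div_iff₀ (by linarith) hN]
    linarith
  have := (convex_Ici (N / 2)).norm_image_sub_le_of_norm_hasDerivWithin_le hd hb
    (show τ ∈ Set.Ici (N / 2) by simp; linarith) (show τ + h ∈ Set.Ici (N / 2) from hh)
  simpa using this

/-- Near the time `τ` the evolved Gaussian is a pure oscillation, up to a small relative error, once
the coefficient `q / w²` of the linear term of the phase is almost real. -/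
lemma exists_evolvedGaussian_eq {a c X N τ : ℝ} (ha : 0 < a) (hN : 0 < N) (hτ : N ≤ τ)
    (hq : ‖((a : ℂ) * c + X * Complex.I) ^ 2‖ ≤ 5 * N ^ 2)
    (him : |(((a : ℂ) * c + X * Complex.I) ^ 2 / (a + (1 + τ * Complex.I)) ^ 2).im| ≤ 4 / N) :
    ∃ μ : ℝ, ∀ h : ℝ, N / 2 ≤ τ + h → ∃ e : ℂ, ‖e‖ ≤ 5 * |h| / N + 10 * h ^ 2 / N ∧
      evolvedGaussian a c X (τ + h) =
        evolvedGaussian a c X τ * Complex.exp ((μ * h : ℝ) * Complex.I + e) := by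
  set q : ℂ := ((a : ℂ) * c + X * Complex.I) ^ 2 with hqdef
  set w : ℂ := a + (1 + τ * Complex.I) with hw
  refine ⟨-(q / w ^ 2).re, fun h hh => ?_⟩
  set w' : ℂ := a + (1 + ((τ + h : ℝ) : ℂ) * Complex.I) with hw'
  have hre : 0 < w.re := by simp [hw]; positivity
  have hre' : 0 < w'.re := by simp [hw']; positivity
  have hne : w ≠ 0 := fun h => by simp [h] at hre
  have hne' : w' ≠ 0 := fun h => by simp [h] at hre'
  have hww : w' = w + h * Complex.I := by rw [hw, hw']; push_cast; ring
  have hwn : N ≤ ‖w‖ := by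
    refine le_trans ?_ (Complex.abs_im_le_norm _)
    have : w.im = τ := by simp [hw]
    rw [this]
    exact hτ.trans (le_abs_self _)
  have hwn' : N / 2 ≤ ‖w'‖ := by
    refine le_trans ?_ (Complex.abs_im_le_norm _)
    have : w'.im = τ + h := by simp [hw']
    rw [this]
    exact hh.trans (le_abs_self _)
  have hpi : (Real.pi : ℂ) ≠ 0 := by exact_mod_cast Real.pi_ne_zero
  set l : ℂ := Complex.log (Real.pi / w') - Complex.log (Real.pi / w) with hl
  refine ⟨1 / 2 * l + ((h * (q / w ^ 2).im : ℝ) : ℂ) + -(q * h ^ 2 / (w ^ 2 * w')), ?_, ?_⟩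
  · have h1 : ‖l‖ ≤ 2 / N * |h| := norm_log_pi_div_sub_le ha hN hτ hh
    have h2 : ‖(1 / 2 : ℂ) * l‖ ≤ |h| / N := by
      rw [norm_mul]
      have : ‖(1 / 2 : ℂ)‖ = 1 / 2 := by norm_num
      rw [this]
      calc 1 / 2 * ‖l‖ ≤ 1 / 2 * (2 / N * |h|) := by gcongr
        _ = |h| / N := by ring
    have h3 : ‖((h * (q / w ^ 2).im : ℝ) : ℂ)‖ ≤ |h| * (4 / N) := by
      rw [Complex.norm_real, Real.norm_eq_abs, abs_mul]
      gcongr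
    have h4 : ‖-(q * h ^ 2 / (w ^ 2 * w'))‖ ≤ 5 * N ^ 2 * h ^ 2 / (N ^ 2 * (N / 2)) := by
      have h5 : ‖(h : ℂ) ^ 2‖ = h ^ 2 := by
        rw [norm_pow, Complex.norm_real, Real.norm_eq_abs, sq_abs]
      rw [norm_neg, norm_div, norm_mul, norm_mul, h5, norm_pow w 2]
      gcongr
    calc _ ≤ |h| / N + |h| * (4 / N) + 5 * N ^ 2 * h ^ 2 / (N ^ 2 * (N / 2)) := by
          refine (norm_add_le _ _).trans (add_le_add ((norm_add_le _ _).trans ?_) h4)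
          exact add_le_add h2 h3
      _ = _ := by
          field_simp
          ring
  · have hpw : (Real.pi / w : ℂ) ≠ 0 := div_ne_zero hpi hne
    have hpw' : (Real.pi / w' : ℂ) ≠ 0 := div_ne_zero hpi hne'
    unfold evolvedGaussian
    rw [← hw, ← hw', ← hqdef, Complex.cpow_def_of_ne_zero hpw, Complex.cpow_def_of_ne_zero hpw',
      mul_assoc, ← Complex.exp_add, ← Complex.exp_add, ← Complex.exp_add]
    congr 2
    have h5 : (((-(q / w ^ 2).re * h : ℝ) : ℂ)) * Complex.I + ((h * (q / w ^ 2).im : ℝ) : ℂ) =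
        -(h * Complex.I) * (q / w ^ 2) := by
      conv_rhs => rw [← Complex.re_add_im (q / w ^ 2)]
      push_cast
      linear_combination ((h : ℂ) * ((q / w ^ 2).im : ℂ)) * Complex.I_sq
    -- Exact second order expansion of `q / w'` around `w`.
    have h6 : q / w' = q / w + -(h * Complex.I) * (q / w ^ 2) + -(q * h ^ 2 / (w ^ 2 * w')) := by
      have hI : (h : ℂ) ^ 2 = -(w' - w) ^ 2 := by
        rw [hww]
        linear_combination (h : ℂ) ^ 2 * Complex.I_sq
      have hI2 : (h : ℂ) * Complex.I = w' - w := by rw [hww]; ring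
      rw [hI, hI2]
      field_simp
      ring
    rw [h6, ← h5, hl]
    ring

lemma norm_evolvedGaussian {a : ℝ} (ha : 0 < a) (c X t : ℝ) :
    ‖evolvedGaussian a c X t‖ = Real.sqrt (a / ‖(a : ℂ) + (1 + t * Complex.I)‖) *
      Real.exp (-(a : ℂ) * c ^ 2 +
        (a * c + X * Complex.I) ^ 2 / (a + (1 + t * Complex.I))).re := by
  have hpi := Real.pi_pos
  unfold evolvedGaussian
  rw [norm_mul, norm_mul, Complex.norm_exp, ← mul_assoc, Complex.norm_real, Real.norm_eq_abs,
    abs_of_nonneg (Real.sqrt_nonneg _),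
    show (1 / 2 : ℂ) = ((1 / 2 : ℝ) : ℂ) by push_cast; rfl, Complex.norm_cpow_real,
    ← Real.sqrt_eq_rpow, ← Real.sqrt_mul (by positivity), norm_div, Complex.norm_real,
    Real.norm_eq_abs, abs_of_pos hpi, div_mul_div_cancel₀ hpi.ne']

lemma norm_add_one_add_mul_I_bounds {a N τ : ℝ} (ha : 0 < a) (haN : a ≤ N) (hN : 1 ≤ N)
    (h1 : N ≤ τ) (h2 : τ ≤ 2 * N) :
    N ≤ ‖(a : ℂ) + (1 + τ * Complex.I)‖ ∧ ‖(a : ℂ) + (1 + τ * Complex.I)‖ ≤ 4 * N := by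
  constructor
  · refine le_trans ?_ (Complex.abs_im_le_norm _)
    have : ((a : ℂ) + (1 + τ * Complex.I)).im = τ := by simp
    rw [this]
    exact h1.trans (le_abs_self _)
  · refine (norm_add_le _ _).trans ?_
    have h3 := norm_add_le (1 : ℂ) (τ * Complex.I)
    rw [norm_one, norm_mul, Complex.norm_I, mul_one, Complex.norm_real, Real.norm_eq_abs,
      abs_of_pos (by linarith)] at h3
    rw [Complex.norm_real, Real.norm_eq_abs, abs_of_pos ha]
    linarith

/-- The principal coordinate, along which the wave packet travels to distance `τ` at time `τ`. -/
lemma evolvedGaussian_principal {N τ : ℝ} (hN : 1 ≤ N) (h1 : N ≤ τ) (h2 : τ ≤ 2 * N) :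
    ‖((N : ℂ) * (1 : ℝ) + τ * Complex.I) ^ 2‖ ≤ 5 * N ^ 2 ∧
    |(((N : ℂ) * (1 : ℝ) + τ * Complex.I) ^ 2 / (N + (1 + τ * Complex.I)) ^ 2).im| ≤ 4 / N ∧
    Real.exp (-2) / 2 ≤ ‖evolvedGaussian N 1 τ τ‖ := by
  have hN0 : 0 < N := by linarith
  obtain ⟨hw1, hw2⟩ := norm_add_one_add_mul_I_bounds hN0 le_rfl hN h1 h2
  set w : ℂ := N + (1 + τ * Complex.I) with hw
  have hwpos : 0 < ‖w‖ := by linarith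
  have hne : w ≠ 0 := norm_pos_iff.1 hwpos
  have hz : (N : ℂ) * (1 : ℝ) + τ * Complex.I = w - 1 := by rw [hw]; push_cast; ring
  refine ⟨?_, ?_, ?_⟩
  · rw [norm_pow, ← Complex.normSq_eq_norm_sq]
    have : Complex.normSq ((N : ℂ) * (1 : ℝ) + τ * Complex.I) = N ^ 2 + τ ^ 2 := by
      simp [Complex.normSq_apply]
      ring
    rw [this]
    nlinarith
  · have h3 : (((N : ℂ) * (1 : ℝ) + τ * Complex.I) ^ 2 / w ^ 2).im =
        (-2 / w + 1 / w ^ 2).im := by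
      have h4 : (w - 1) ^ 2 / w ^ 2 = ((1 : ℝ) : ℂ) + (-2 / w + 1 / w ^ 2) := by
        field_simp
        push_cast
        ring
      rw [hz, h4, Complex.add_im, Complex.ofReal_im, zero_add]
    rw [h3]
    refine (Complex.abs_im_le_norm _).trans ((norm_add_le _ _).trans ?_)
    rw [norm_div, norm_div, norm_neg, norm_one, norm_pow]
    have h3 : ‖(2 : ℂ)‖ = 2 := by simp
    rw [h3]
    have h4 : 2 / ‖w‖ ≤ 2 / N := by gcongr
    have h5 : 1 / ‖w‖ ^ 2 ≤ 1 / N ^ 2 := by gcongr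
    have h6 : 1 / N ^ 2 ≤ 1 / N := by gcongr; nlinarith
    have h7 : 4 / N = 2 / N + 1 / N + 1 / N := by ring
    have h8 : 0 < 1 / N := by positivity
    linarith
  · rw [norm_evolvedGaussian hN0, ← hw, hz]
    have h3 : (-(N : ℂ) * (1 : ℝ) ^ 2 + (w - 1) ^ 2 / w).re = -1 + (w⁻¹).re := by
      have h4 : -(N : ℂ) * (1 : ℝ) ^ 2 + (w - 1) ^ 2 / w = -N + w - 2 + w⁻¹ := by
        field_simp
        push_cast
        ring
      rw [h4]
      simp [hw]
      ring
    have h5 : 0 ≤ (w⁻¹).re := by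
      rw [Complex.inv_re]
      refine div_nonneg ?_ (Complex.normSq_nonneg _)
      simp [hw]
      linarith
    have h6 : (1 : ℝ) / 2 ≤ Real.sqrt (N / ‖w‖) := by
      refine Real.le_sqrt_of_sq_le ?_
      rw [le_div_iff₀ hwpos]
      linarith
    have h7 : Real.exp (-2) ≤ Real.exp (-1 + (w⁻¹).re) := Real.exp_le_exp.2 (by linarith)
    rw [h3]
    calc Real.exp (-2) / 2 = 1 / 2 * Real.exp (-2) := by ring
      _ ≤ _ := mul_le_mul h6 h7 (Real.exp_pos _).le (Real.sqrt_nonneg _)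

/-- The transversal coordinates, in which the packet spreads to distance `N`. -/
lemma evolvedGaussian_transversal {N τ X : ℝ} (hN : 1 ≤ N) (h1 : N ≤ τ) (h2 : τ ≤ 2 * N)
    (hX : |X| ≤ N) :
    ‖(((1 : ℝ) : ℂ) * (0 : ℝ) + X * Complex.I) ^ 2‖ ≤ 5 * N ^ 2 ∧
    |((((1 : ℝ) : ℂ) * (0 : ℝ) + X * Complex.I) ^ 2 /
      (((1 : ℝ) : ℂ) + (1 + τ * Complex.I)) ^ 2).im| ≤ 4 / N ∧
    Real.exp (-2) / 2 * N ^ (-(1 / 2) : ℝ) ≤ ‖evolvedGaussian 1 0 X τ‖ := by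
  have hN0 : 0 < N := by linarith
  have hτ : 0 < τ := by linarith
  have hX2 : X ^ 2 ≤ N ^ 2 := by rw [← sq_abs X]; gcongr
  have hNτ : N ^ 2 ≤ τ ^ 2 := by gcongr
  obtain ⟨hw1, hw2⟩ := norm_add_one_add_mul_I_bounds one_pos hN hN h1 h2
  have hq : (((1 : ℝ) : ℂ) * (0 : ℝ) + X * Complex.I) ^ 2 = ((-X ^ 2 : ℝ) : ℂ) := by
    push_cast
    linear_combination (X : ℂ) ^ 2 * Complex.I_sq
  have hw : ((1 : ℝ) : ℂ) + (1 + τ * Complex.I) = 2 + τ * Complex.I := by push_cast; ring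
  have hd : (0 : ℝ) < 4 + τ ^ 2 := by positivity
  have hinv : (2 + τ * Complex.I)⁻¹ = ((2 / (4 + τ ^ 2) : ℝ) : ℂ) +
      ((-τ / (4 + τ ^ 2) : ℝ) : ℂ) * Complex.I := by
    refine inv_eq_of_mul_eq_one_right ?_
    have hd' : (4 + (τ : ℂ) ^ 2) ≠ 0 := by exact_mod_cast hd.ne'
    push_cast
    field_simp
    linear_combination (-(τ : ℂ) ^ 2) * Complex.I_sq
  refine ⟨?_, ?_, ?_⟩
  · rw [hq, Complex.norm_real, Real.norm_eq_abs, abs_neg, abs_of_nonneg (sq_nonneg X)]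
    nlinarith
  · have h3 : (((-X ^ 2 : ℝ) : ℂ) / (2 + τ * Complex.I) ^ 2).im =
        4 * τ * X ^ 2 / (4 + τ ^ 2) ^ 2 := by
      have h4 : ∀ A B : ℝ, (((A : ℂ) + (B : ℂ) * Complex.I) ^ 2).im = 2 * A * B := fun A B => by
        simp [pow_two]
        ring
      rw [div_eq_mul_inv, ← inv_pow, hinv, Complex.im_ofReal_mul, h4]
      field_simp
      ring
    rw [hq, hw, h3, abs_of_nonneg (by positivity), div_le_div_iff₀ (by positivity) hN0]
    have h4 : τ * N ≤ 4 + τ ^ 2 := by nlinarith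
    have h5 : X ^ 2 ≤ 4 + τ ^ 2 := by linarith
    have h6 := mul_le_mul h4 h5 (sq_nonneg X) hd.le
    nlinarith
  · rw [norm_evolvedGaussian one_pos, hq]
    have h3 : (-((1 : ℝ) : ℂ) * (0 : ℝ) ^ 2 + ((-X ^ 2 : ℝ) : ℂ) /
        (((1 : ℝ) : ℂ) + (1 + τ * Complex.I))).re = -(2 * X ^ 2 / (4 + τ ^ 2)) := by
      have h4 : ∀ A B : ℝ, ((A : ℂ) + (B : ℂ) * Complex.I).re = A := fun A B => by simp
      rw [hw, div_eq_mul_inv, hinv, Complex.add_re, Complex.re_ofReal_mul, h4]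
      simp
      ring
    have h5 : 2 * X ^ 2 / (4 + τ ^ 2) ≤ 2 := by
      rw [div_le_iff₀ hd]
      linarith
    have h6 : 1 / 2 * N ^ (-(1 / 2) : ℝ) ≤
        Real.sqrt (1 / ‖((1 : ℝ) : ℂ) + (1 + τ * Complex.I)‖) := by
      refine Real.le_sqrt_of_sq_le ?_
      rw [mul_pow, ← Real.rpow_natCast (N ^ (-(1 / 2) : ℝ)) 2, ← Real.rpow_mul hN0.le]
      norm_num
      rw [Real.rpow_neg_one]
      norm_num at hw1 hw2
      calc (1 : ℝ) / 4 * N⁻¹ = (4 * N)⁻¹ := by rw [mul_inv, one_div]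
        _ ≤ _ := inv_anti₀ (by linarith) hw2
    rw [h3]
    calc Real.exp (-2) / 2 * N ^ (-(1 / 2) : ℝ) =
        1 / 2 * N ^ (-(1 / 2) : ℝ) * Real.exp (-2) := by ring
      _ ≤ _ := mul_le_mul h6 (Real.exp_le_exp.2 (by linarith)) (Real.exp_pos _).le
        (Real.sqrt_nonneg _)

/-! ### The maximal function of the wave packet -/

/-- The squared widths, up to a constant, of the wave packet: `N` in the principal direction `j₀` and
`1` in the others. -/
noncomputable def packetWidth {n : ℕ} (j₀ : Fin n) (N : ℝ) (j : Fin n) : ℝ :=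
  if j = j₀ then N else 1

/-- The frequency of the wave packet, the unit vector of the principal direction. -/
noncomputable def packetFrequency {n : ℕ} (j₀ : Fin n) (j : Fin n) : ℝ := if j = j₀ then 1 else 0

lemma packetWidth_pos {n : ℕ} (j₀ : Fin n) {N : ℝ} (hN : 0 < N) (j : Fin n) :
    0 < packetWidth j₀ N j := by
  unfold packetWidth
  split_ifs
  · exact hN
  · exact one_pos

/-- The complex Gaussian multiplier at `s = 1 + it`, applied to the wave packet, at `X / π`. -/
noncomputable def evolvedPacket {n : ℕ} (j₀ : Fin n) (N : ℝ) (X : Fin n → ℝ) (t : ℝ) : ℂ :=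
  ∏ j, evolvedGaussian (packetWidth j₀ N j) (packetFrequency j₀ j) (X j) t

lemma integral_packet_eq_evolvedPacket {n : ℕ} (j₀ : Fin n) {N : ℝ} (hN : 0 < N)
    (x : EuclideanSpace ℝ (Fin n)) (t : ℝ) :
    ∫ ξ : EuclideanSpace ℝ (Fin n), Complex.exp (-(1 + (t : ℂ) * Complex.I) * (‖ξ‖ : ℂ) ^ 2) *
      (𝓕 (modulatedGaussian (packetWidth j₀ N) (packetFrequency j₀) (packetWidth_pos j₀ hN) :
          EuclideanSpace ℝ (Fin n) → ℂ) ξ *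
        Complex.exp (2 * Real.pi * Complex.I * ((inner ℝ x ξ : ℝ) : ℂ))) =
      evolvedPacket j₀ N (fun j => Real.pi * x j) t := by
  rw [integral_cexp_mul_fourier_modulatedGaussian _ _ _ (by simp)]
  unfold evolvedPacket evolvedGaussian
  refine Finset.prod_congr rfl fun j _ => ?_
  have : (Real.pi : ℂ) * Complex.I * ((x j : ℝ) : ℂ) =
      ((Real.pi * x j : ℝ) : ℂ) * Complex.I := by push_cast; ring
  rw [this]

lemma continuous_evolvedPacket {n : ℕ} (j₀ : Fin n) {N : ℝ} (hN : 0 < N) (X : Fin n → ℝ) :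
    Continuous (evolvedPacket j₀ N X) := by
  unfold evolvedPacket
  exact continuous_finsetProd _ fun j _ => continuous_evolvedGaussian (packetWidth_pos j₀ hN j) _ _

/-- Size and phase of the evolved packet near the time at which it passes the given point. -/
lemma evolvedPacket_near_passage {n : ℕ} (j₀ : Fin n) {N : ℝ} (hN : 1 ≤ N) {X : Fin n → ℝ}
    (h1 : N ≤ X j₀) (h2 : X j₀ ≤ 2 * N) (hX : ∀ j ≠ j₀, |X j| ≤ N) :
    (Real.exp (-2) / 2) ^ n * N ^ (-((n : ℝ) - 1) / 2) ≤ ‖evolvedPacket j₀ N X (X j₀)‖ ∧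
    ∃ μ : ℝ, ∀ h : ℝ, N / 2 ≤ X j₀ + h → ∃ e : ℂ, ‖e‖ ≤ n * (5 * |h| / N + 10 * h ^ 2 / N) ∧
      evolvedPacket j₀ N X (X j₀ + h) =
        evolvedPacket j₀ N X (X j₀) * Complex.exp ((μ * h : ℝ) * Complex.I + e) := by
  have hN0 : 0 < N := by linarith
  constructor
  · have hlow : ∀ j, Real.exp (-2) / 2 * (if j = j₀ then 1 else N ^ (-(1 / 2) : ℝ)) ≤
        ‖evolvedGaussian (packetWidth j₀ N j) (packetFrequency j₀ j) (X j) (X j₀)‖ := by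
      intro j
      unfold packetWidth packetFrequency
      by_cases hj : j = j₀
      · subst hj
        simpa using (evolvedGaussian_principal hN h1 h2).2.2
      · simpa [hj] using (evolvedGaussian_transversal hN h1 h2 (hX j hj)).2.2
    unfold evolvedPacket
    rw [norm_prod]
    refine le_trans (le_of_eq ?_) (Finset.prod_le_prod (fun j _ => ?_) fun j _ => hlow j)
    · rw [Finset.prod_mul_distrib, Finset.prod_const, Finset.card_univ, Fintype.card_fin,
        Finset.prod_ite, Finset.prod_const_one, one_mul, Finset.prod_const,
        Finset.filter_ne' , Finset.card_erase_of_mem (Finset.mem_univ _), Finset.card_univ,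
        Fintype.card_fin, ← Real.rpow_natCast (N ^ _), ← Real.rpow_mul hN0.le]
      congr 2
      have : 1 ≤ n := Nat.one_le_of_lt j₀.2
      push_cast [Nat.cast_sub this]
      ring
    · split_ifs <;> positivity
  · have hex : ∀ j, ∃ μ : ℝ, ∀ h : ℝ, N / 2 ≤ X j₀ + h → ∃ e : ℂ,
        ‖e‖ ≤ 5 * |h| / N + 10 * h ^ 2 / N ∧
        evolvedGaussian (packetWidth j₀ N j) (packetFrequency j₀ j) (X j) (X j₀ + h) =
          evolvedGaussian (packetWidth j₀ N j) (packetFrequency j₀ j) (X j) (X j₀) *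
            Complex.exp ((μ * h : ℝ) * Complex.I + e) := by
      intro j
      have hp := packetWidth_pos j₀ hN0 j
      unfold packetWidth packetFrequency at *
      by_cases hj : j = j₀
      · subst hj
        obtain ⟨h3, h4, -⟩ := evolvedGaussian_principal hN h1 h2
        simp only [if_true] at hp ⊢
        exact exists_evolvedGaussian_eq hp hN0 h1 h3 h4
      · obtain ⟨h3, h4, -⟩ := evolvedGaussian_transversal hN h1 h2 (hX j hj)
        simp only [hj, if_false] at hp ⊢
        exact exists_evolvedGaussian_eq hp hN0 h1 h3 h4
    choose μ hμ using hex
    refine ⟨∑ j, μ j, fun h hh => ?_⟩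
    choose e he1 he2 using fun j => hμ j h hh
    refine ⟨∑ j, e j, ?_, ?_⟩
    · refine (norm_sum_le _ _).trans ((Finset.sum_le_sum fun j _ => he1 j).trans (le_of_eq ?_))
      rw [Finset.sum_const, Finset.card_univ, Fintype.card_fin, nsmul_eq_mul]
    · unfold evolvedPacket
      simp_rw [he2]
      rw [Finset.prod_mul_distrib, ← Complex.exp_sum]
      congr 2
      simp only [Finset.sum_add_distrib, Finset.sum_mul, Complex.ofReal_mul, Complex.ofReal_sum]

lemma integral_window : ∫ θ in (-1 : ℝ)..1, (1 - θ ^ 2) ^ 2 = 16 / 15 := by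
  have h : ∀ θ : ℝ, (1 - θ ^ 2) ^ 2 = 1 - 2 * θ ^ 2 + θ ^ 4 := fun θ => by ring
  simp_rw [h]
  rw [intervalIntegral.integral_add (Continuous.intervalIntegrable (by fun_prop) _ _)
      (Continuous.intervalIntegrable (by fun_prop) _ _),
    intervalIntegral.integral_sub (Continuous.intervalIntegrable (by fun_prop) _ _)
      (Continuous.intervalIntegrable (by fun_prop) _ _), intervalIntegral.integral_const_mul,
    integral_pow, integral_pow]
  norm_num

/-- No cancellation occurs in the integral of a function whose relative deviation from a constant
is at most one half. -/
lemma le_norm_integral_window_mul {F : ℝ → ℂ} (hF : Continuous F) {A : ℂ}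
    (h : ∀ θ ∈ Set.Icc (-1 : ℝ) 1, ‖F θ - A‖ ≤ 1 / 2 * ‖A‖) :
    8 / 15 * ‖A‖ ≤ ‖∫ θ in (-1 : ℝ)..1, (1 - (θ : ℂ) ^ 2) ^ 2 * F θ‖ := by
  have hcast : ∀ θ : ℝ, (1 - (θ : ℂ) ^ 2) ^ 2 = (((1 - θ ^ 2) ^ 2 : ℝ) : ℂ) := fun θ => by
    push_cast; rfl
  have h1 : ∫ θ in (-1 : ℝ)..1, (1 - (θ : ℂ) ^ 2) ^ 2 * F θ =
      16 / 15 * A + ∫ θ in (-1 : ℝ)..1, (1 - (θ : ℂ) ^ 2) ^ 2 * (F θ - A) := by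
    have h2 : (16 / 15 : ℂ) * A = ∫ θ in (-1 : ℝ)..1, (1 - (θ : ℂ) ^ 2) ^ 2 * A := by
      rw [intervalIntegral.integral_mul_const]
      simp_rw [hcast]
      rw [intervalIntegral.integral_ofReal, integral_window]
      push_cast
      rfl
    rw [h2, ← intervalIntegral.integral_add (Continuous.intervalIntegrable (by fun_prop) _ _)
      (Continuous.intervalIntegrable (by fun_prop) _ _)]
    congr 1
    funext θ
    ring
  have h3 : ‖∫ θ in (-1 : ℝ)..1, (1 - (θ : ℂ) ^ 2) ^ 2 * (F θ - A)‖ ≤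
      ∫ θ in (-1 : ℝ)..1, (1 - θ ^ 2) ^ 2 * (1 / 2 * ‖A‖) := by
    refine intervalIntegral.norm_integral_le_of_norm_le (by norm_num) ?_
      (Continuous.intervalIntegrable (by fun_prop) _ _)
    refine .of_forall fun θ hθ => ?_
    rw [norm_mul, hcast, Complex.norm_real, Real.norm_eq_abs, abs_of_nonneg (sq_nonneg _)]
    exact mul_le_mul_of_nonneg_left (h θ ⟨hθ.1.le, hθ.2⟩) (sq_nonneg _)
  rw [intervalIntegral.integral_mul_const, integral_window] at h3
  have h4 : ‖(16 / 15 : ℂ) * A‖ = 16 / 15 * ‖A‖ := by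
    rw [norm_mul]
    norm_num
  have h5 := norm_sub_le_norm_add ((16 / 15 : ℂ) * A)
    (∫ θ in (-1 : ℝ)..1, (1 - (θ : ℂ) ^ 2) ^ 2 * (F θ - A))
  rw [h1]
  linarith

lemma exists_rpow_mul_exp_neg_le {α : ℝ} (hα : 0 ≤ α) :
    ∃ K : ℝ, 0 < K ∧ ∀ v : ℝ, 0 < v → v ^ α * Real.exp (-v) ≤ K := by
  obtain ⟨m, hm⟩ := exists_nat_ge α
  refine ⟨Real.exp 1 * m.factorial, by positivity, fun v hv => ?_⟩
  rw [Real.exp_neg, ← div_eq_mul_inv, div_le_iff₀ (Real.exp_pos _), mul_assoc, mul_left_comm,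
    ← Real.exp_add, add_comm 1 v]
  have h1 := Real.pow_div_factorial_le_exp (v + 1) (by positivity) m
  rw [div_le_iff₀ (by positivity)] at h1
  calc v ^ α ≤ (v + 1) ^ α := Real.rpow_le_rpow hv.le (by linarith) hα
    _ ≤ (v + 1) ^ (m : ℝ) := Real.rpow_le_rpow_of_exponent_le (by linarith) hm
    _ = (v + 1) ^ m := Real.rpow_natCast _ _
    _ ≤ _ := by linarith

/-- The maximal function of the wave packet on the region reached by it at times comparable with
`N`. -/
lemma exists_le_maximalBochnerRiesz_packet {n k : ℕ} (hk : 1 ≤ k) {α : ℝ} (hα : 0 ≤ α)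
    (j₀ : Fin n) :
    ∃ C : ℝ, 0 < C ∧ ∀ (N : ℝ) (hN : 1 ≤ N) (x : EuclideanSpace ℝ (Fin n)),
      N ≤ Real.pi * x j₀ → Real.pi * x j₀ ≤ 2 * N → (∀ j ≠ j₀, |Real.pi * x j| ≤ N) →
      ENNReal.ofReal (C * N ^ (-(α + 1 / 2) - ((n : ℝ) - 1) * k / 2)) ≤
        maximalBochnerRiesz α (fun _ : Fin k =>
          (modulatedGaussian (packetWidth j₀ N) (packetFrequency j₀)
            (packetWidth_pos j₀ (one_pos.trans_le hN)) : EuclideanSpace ℝ (Fin n) → ℂ)) x := by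
  obtain ⟨K, hK0, hK⟩ := exists_rpow_mul_exp_neg_le hα
  have hn : 1 ≤ n := Nat.one_le_of_lt j₀.2
  have hΓ : 0 < Real.Gamma (α + 1) := Real.Gamma_pos_of_pos (by linarith)
  -- With `δ = c₀ √N` the `k n` phase errors `5 δ / N + 10 δ² / N` add up to at most `1 / 4`.
  set c₀ : ℝ := 1 / (60 * (k * n)) with hc₀
  have hkn : (1 : ℝ) ≤ k * n := by
    have : 1 ≤ k * n := Nat.one_le_iff_ne_zero.2 (by positivity)
    exact_mod_cast this
  have hc0 : 0 < c₀ := by positivity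
  have hc1 : c₀ ≤ 1 / 2 := by
    rw [hc₀, div_le_div_iff₀ (by positivity) (by norm_num)]
    linarith
  set A : ℝ := 8 + 8 * (α + 1) + (α + 1) ^ 2 with hA
  have hA0 : 0 < A := by positivity
  set d : ℝ := (Real.exp (-2) / 2) ^ n with hd
  have hd0 : 0 < d := by positivity
  set D : ℝ := K * (4 * (A * 4 ^ (α + 1)) * (Real.pi / c₀)) with hD
  have hD0 : 0 < D := by
    have := Real.pi_pos
    positivity
  refine ⟨Real.Gamma (α + 1) * (8 / 15) * d ^ k / D, by positivity, fun N hN x h1 h2 hX => ?_⟩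
  have hN0 : 0 < N := by linarith
  set f : Fin k → SchwartzMap (EuclideanSpace ℝ (Fin n)) ℂ := fun _ =>
    modulatedGaussian (packetWidth j₀ N) (packetFrequency j₀)
            (packetWidth_pos j₀ (one_pos.trans_le hN)) with hf
  set S := maximalBochnerRiesz α (fun i => (f i : EuclideanSpace ℝ (Fin n) → ℂ)) x with hS
  -- An infinite maximal function satisfies the bound trivially.
  rcases eq_or_ne S ⊤ with htop | htop
  · exact htop ▸ le_top
  have hT : ∀ R > 0, ‖bochnerRieszMean α R
      (fun i => (f i : EuclideanSpace ℝ (Fin n) → ℂ)) x‖ ≤ S.toReal := by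
    intro R hR
    have h3 : ‖bochnerRieszMean α R
      (fun i => (f i : EuclideanSpace ℝ (Fin n) → ℂ)) x‖ₑ ≤ S := le_iSup₂_of_le R hR le_rfl
    have h4 := ENNReal.toReal_mono htop h3
    simpa using h4
  rw [ENNReal.ofReal_le_iff_le_toReal htop]
  set X : Fin n → ℝ := fun j => Real.pi * x j with hXdef
  set τ : ℝ := X j₀ with hτ
  set δ : ℝ := c₀ * Real.sqrt N with hδ
  have hsN : Real.sqrt N ^ 2 = N := Real.sq_sqrt hN0.le
  have hs1 : 1 ≤ Real.sqrt N := Real.one_le_sqrt.2 hN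
  have hsle : Real.sqrt N ≤ N := by nlinarith
  have hδ0 : 0 < δ := by positivity
  have hδN : δ ≤ N / 2 := by
    calc δ ≤ 1 / 2 * N := mul_le_mul hc1 hsle (by positivity) (by norm_num)
      _ = N / 2 := by ring
  obtain ⟨hlow, μ, hμ⟩ := evolvedPacket_near_passage j₀ hN (X := X) h1 h2 hX
  have hmain := norm_integral_window_evolution_le hα f x hT hK (τ := τ) hδ0
    (by linarith) (L := 4 * N) (by linarith) (k * μ)
  simp only [hf, integral_packet_eq_evolvedPacket j₀ hN0, Finset.prod_const, Finset.card_univ,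
    Fintype.card_fin] at hmain
  have hwin := le_norm_integral_window_mul (A := evolvedPacket j₀ N X τ ^ k)
    (F := fun θ : ℝ => Complex.exp (-((k * μ) * (δ * θ) : ℝ) * Complex.I) *
      evolvedPacket j₀ N X (τ + δ * θ) ^ k) (by
        have := continuous_evolvedPacket j₀ hN0 X
        fun_prop) (fun θ hθ => by
      have habs : |θ| ≤ 1 := abs_le.2 hθ
      obtain ⟨e, he1, he2⟩ := hμ (δ * θ) (by nlinarith [hθ.1])
      have h3 : Complex.exp (-((k * μ) * (δ * θ) : ℝ) * Complex.I) *
          evolvedPacket j₀ N X (τ + δ * θ) ^ k - evolvedPacket j₀ N X τ ^ k =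
          evolvedPacket j₀ N X τ ^ k * (Complex.exp (k * e) - 1) := by
        rw [he2, mul_pow, ← Complex.exp_nat_mul, mul_left_comm, ← Complex.exp_add, mul_sub, mul_one]
        congr 3
        push_cast
        ring
      have h4 : ‖(k : ℂ) * e‖ ≤ 1 / 4 := by
        rw [norm_mul, Complex.norm_natCast]
        have h5 : |δ * θ| ≤ c₀ * Real.sqrt N := by
          rw [abs_mul, abs_of_pos hδ0]
          exact mul_le_of_le_one_right hδ0.le habs
        have h6 : 5 * |δ * θ| / N ≤ 5 * c₀ := by
          rw [div_le_iff₀ hN0]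
          nlinarith
        have h7 : 10 * (δ * θ) ^ 2 / N ≤ 10 * c₀ := by
          rw [div_le_iff₀ hN0, ← sq_abs (δ * θ)]
          have h8 : |δ * θ| ^ 2 ≤ (c₀ * Real.sqrt N) ^ 2 := by gcongr
          rw [mul_pow, hsN] at h8
          nlinarith [mul_le_mul_of_nonneg_right hc1 (mul_pos hc0 hN0).le]
        calc (k : ℝ) * ‖e‖ ≤ k * (n * (5 * c₀ + 10 * c₀)) := by
              gcongr
              refine he1.trans ?_
              gcongr
          _ = (k * n) * c₀ * 15 := by ring
          _ = 1 / 4 := by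
              rw [hc₀]
              field_simp
              norm_num
      have h8 := Complex.norm_exp_sub_one_le (x := k * e) (by linarith)
      rw [h3, norm_mul, mul_comm]
      gcongr
      linarith)
  have hfun : ∀ θ : ℝ, (1 - (θ : ℂ) ^ 2) ^ 2 *
      (Complex.exp (-((k * μ) * (δ * θ) : ℝ) * Complex.I) *
        evolvedPacket j₀ N X (τ + δ * θ) ^ k) = (1 - (θ : ℂ) ^ 2) ^ 2 *
      Complex.exp (-((k * μ) * (δ * θ) : ℝ) * Complex.I) *
        evolvedPacket j₀ N X (τ + δ * θ) ^ k := fun θ => by ring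
  simp only [hfun] at hwin
  have hlowk : (d * N ^ (-((n : ℝ) - 1) / 2)) ^ k ≤ ‖evolvedPacket j₀ N X τ ^ k‖ := by
    rw [norm_pow]
    gcongr
  have hfin : Real.Gamma (α + 1) * (8 / 15 * (d * N ^ (-((n : ℝ) - 1) / 2)) ^ k) ≤
      S.toReal * K * (4 * (A * (4 * N) ^ (α + 1)) * (Real.pi / δ)) := by
    refine le_trans ?_ hmain
    gcongr
    refine le_trans ?_ hwin
    gcongr
  have hexp : K * (4 * (A * (4 * N) ^ (α + 1)) * (Real.pi / δ)) = D * N ^ (α + 1 / 2) := by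
    rw [hD, hδ, Real.mul_rpow (by norm_num) hN0.le, Real.sqrt_eq_rpow,
      show α + 1 = (α + 1 / 2) + 1 / 2 by ring, Real.rpow_add hN0]
    have : 0 < N ^ (1 / 2 : ℝ) := by positivity
    field_simp
  rw [mul_assoc, hexp, mul_pow, ← Real.rpow_natCast (N ^ _) k, ← Real.rpow_mul hN0.le] at hfin
  have hsplit : N ^ (-(α + 1 / 2) - ((n : ℝ) - 1) * k / 2) =
      N ^ (-((n : ℝ) - 1) / 2 * k) / N ^ (α + 1 / 2) := by
    rw [← Real.rpow_sub hN0]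
    congr 1
    ring
  rw [hsplit, div_mul_div_comm, div_le_iff₀ (by positivity)]
  linarith

/-! ### Dilated packets and the failure of the maximal estimate -/

/-- A diagonal linear map of determinant one preserves Lebesgue measure on Euclidean space. -/
lemma measurePreserving_diagonal {n : ℕ} {D : Fin n → ℝ} (hD : ∏ j, D j = 1) :
    MeasurePreserving (fun y : EuclideanSpace ℝ (Fin n) =>
      (WithLp.toLp 2 (fun j => D j * y j) : EuclideanSpace ℝ (Fin n))) := by
  have h1 : MeasurePreserving (fun v : Fin n → ℝ => fun j => D j * v j) := by
    refine ⟨by fun_prop, ?_⟩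
    have h2 := Real.smul_map_diagonal_volume_pi (D := D) (by
      rw [Matrix.det_diagonal, hD]
      exact one_ne_zero)
    rw [Matrix.det_diagonal, hD, abs_one, ENNReal.ofReal_one, one_smul] at h2
    have h3 : ⇑(Matrix.toLin' (Matrix.diagonal D)) = fun v : Fin n → ℝ => fun j => D j * v j := by
      funext v j
      simp [Matrix.mulVec_diagonal]
    rwa [h3] at h2
  exact (PiLp.volume_preserving_toLp (Fin n)).comp (h1.comp (PiLp.volume_preserving_ofLp (Fin n)))

lemma norm_modulatedGaussian {n : ℕ} (a c : Fin n → ℝ) (ha : ∀ j, 0 < a j)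
    (y : EuclideanSpace ℝ (Fin n)) :
    ‖modulatedGaussian a c ha y‖ = Real.exp (∑ j, -(Real.pi ^ 2 / a j) * y j ^ 2) := by
  rw [modulatedGaussian_apply, Complex.norm_exp, gaussianExponent_re]

/-- Every `L^q` norm of a modulated Gaussian whose squared widths have product one equals that of
the unmodulated Gaussian with all widths equal, as the two are related by a diagonal map of
determinant one. -/
lemma eLpNorm_modulatedGaussian {n : ℕ} {a : Fin n → ℝ} (c : Fin n → ℝ) (ha : ∀ j, 0 < a j)
    (hprod : ∏ j, a j = 1) (q : ℝ≥0∞) :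
    eLpNorm (modulatedGaussian a c ha) q volume =
      eLpNorm (modulatedGaussian (fun _ : Fin n => 1) 0 fun _ => one_pos) q volume := by
  have hD : ∏ j, (Real.sqrt (a j))⁻¹ = 1 := by
    rw [Finset.prod_inv_distrib, ← Real.sqrt_prod _ fun j _ => (ha j).le, hprod, Real.sqrt_one,
      inv_one]
  rw [← eLpNorm_comp_measurePreserving
    (modulatedGaussian (fun _ : Fin n => 1) 0 fun _ => one_pos).continuous.aestronglyMeasurable
    (measurePreserving_diagonal hD)]
  refine eLpNorm_congr_norm_ae (.of_forall fun y => ?_)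
  rw [Function.comp_apply, norm_modulatedGaussian, norm_modulatedGaussian]
  congr 1
  refine Finset.sum_congr rfl fun j _ => ?_
  simp only [mul_pow, inv_pow, Real.sq_sqrt (ha j).le]
  field_simp

lemma modulatedGaussian_smul {n : ℕ} {a : Fin n → ℝ} (c : Fin n → ℝ) (ha : ∀ j, 0 < a j) {l : ℝ}
    (hl : 0 < l) (y : EuclideanSpace ℝ (Fin n)) :
    modulatedGaussian (fun j => a j / l ^ 2) (fun j => l * c j)
      (fun j => div_pos (ha j) (by positivity)) y = modulatedGaussian a c ha (l • y) := by
  rw [modulatedGaussian_apply, modulatedGaussian_apply, gaussianExponent, gaussianExponent]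
  congr 1
  refine Finset.sum_congr rfl fun j _ => ?_
  have hlc : (l : ℂ) ≠ 0 := by exact_mod_cast hl.ne'
  rw [PiLp.smul_apply, smul_eq_mul]
  push_cast
  field_simp

/-- The points with principal coordinate in `[r, 2r]` and all other coordinates in `[0, r]`. -/
def passageBox {n : ℕ} (j₀ : Fin n) (r : ℝ) : Set (EuclideanSpace ℝ (Fin n)) :=
  WithLp.ofLp ⁻¹' Set.Icc (fun j => if j = j₀ then r else 0)
    (fun j => if j = j₀ then 2 * r else r)

lemma measurableSet_passageBox {n : ℕ} (j₀ : Fin n) (r : ℝ) :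
    MeasurableSet (passageBox j₀ r) :=
  measurableSet_Icc.preimage (PiLp.volume_preserving_ofLp (Fin n)).measurable

lemma volume_passageBox {n : ℕ} (j₀ : Fin n) (r : ℝ) :
    volume (passageBox j₀ r) = ENNReal.ofReal r ^ n := by
  unfold passageBox
  rw [(PiLp.volume_preserving_ofLp (Fin n)).measure_preimage measurableSet_Icc.nullMeasurableSet,
    Real.volume_Icc_pi]
  rw [Finset.prod_congr rfl fun j _ => show ENNReal.ofReal ((if j = j₀ then 2 * r else r) -
    if j = j₀ then r else 0) = ENNReal.ofReal r by split_ifs <;> ring_nf]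
  simp

lemma mem_passageBox_iff {n : ℕ} {j₀ : Fin n} {r : ℝ} {x : EuclideanSpace ℝ (Fin n)} :
    x ∈ passageBox j₀ r ↔ (r ≤ x j₀ ∧ x j₀ ≤ 2 * r) ∧ ∀ j ≠ j₀, 0 ≤ x j ∧ x j ≤ r := by
  simp only [passageBox, Set.mem_preimage, Set.mem_Icc, Pi.le_def]
  constructor
  · rintro ⟨h1, h2⟩
    refine ⟨⟨by simpa using h1 j₀, by simpa using h2 j₀⟩, fun j hj => ⟨?_, ?_⟩⟩
    · simpa [hj] using h1 j
    · simpa [hj] using h2 j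
  · rintro ⟨⟨h1, h2⟩, h3⟩
    refine ⟨fun j => ?_, fun j => ?_⟩
    · split_ifs with hj
      · exact hj ▸ h1
      · exact (h3 j hj).1
    · split_ifs with hj
      · exact hj ▸ h2
      · exact (h3 j hj).2

/-- The wave packet of parameter `N = l ^ (2n)`, dilated by `l` so that the product of its widths
is one. -/
noncomputable def dilatedPacket {n : ℕ} (j₀ : Fin n) {l : ℝ} (hl : 0 < l) :
    SchwartzMap (EuclideanSpace ℝ (Fin n)) ℂ :=
  modulatedGaussian (fun j => packetWidth j₀ (l ^ (2 * n)) j / l ^ 2)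
    (fun j => l * packetFrequency j₀ j)
    (fun j => div_pos (packetWidth_pos j₀ (by positivity) j) (by positivity))

lemma eLpNorm_dilatedPacket {n : ℕ} (j₀ : Fin n) {l : ℝ} (hl : 0 < l) (q : ℝ≥0∞) :
    eLpNorm (dilatedPacket j₀ hl) q volume =
      eLpNorm (modulatedGaussian (fun _ : Fin n => 1) 0 fun _ => one_pos) q volume := by
  refine eLpNorm_modulatedGaussian _ _ ?_ q
  rw [Finset.prod_div_distrib, Finset.prod_const, Finset.card_univ, Fintype.card_fin, ← pow_mul]
  unfold packetWidth
  rw [Finset.prod_ite_eq' Finset.univ j₀ (fun _ => l ^ (2 * n))]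
  simp [hl.ne']

lemma exists_le_maximalBochnerRiesz_dilatedPacket {n k : ℕ} (hk : 1 ≤ k) {α : ℝ} (hα : 0 ≤ α)
    (j₀ : Fin n) :
    ∃ c : ℝ, 0 < c ∧ ∀ (l : ℝ) (hl : 1 ≤ l), ∀ x ∈ passageBox j₀ (l ^ (2 * n) / (Real.pi * l)),
      ENNReal.ofReal (c * (l ^ (2 * n)) ^ (-(α + 1 / 2) - ((n : ℝ) - 1) * k / 2)) ≤
        maximalBochnerRiesz α (fun _ : Fin k =>
          (dilatedPacket j₀ (one_pos.trans_le hl) : EuclideanSpace ℝ (Fin n) → ℂ)) x := by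
  obtain ⟨c, hc0, hc⟩ := exists_le_maximalBochnerRiesz_packet hk hα j₀
  refine ⟨c, hc0, fun l hl x hx => ?_⟩
  have hpi := Real.pi_pos
  have hl0 : 0 < l := by linarith
  have hN1 : 1 ≤ l ^ (2 * n) := one_le_pow₀ hl
  generalize hN : l ^ (2 * n) = N at *
  have hN0 : 0 < N := by linarith
  have hW := packetWidth_pos j₀ hN0
  obtain ⟨⟨h1, h2⟩, h3⟩ := mem_passageBox_iff.1 hx
  generalize hr : N / (Real.pi * l) = r at *
  have hrN : Real.pi * (l * r) = N := by rw [← hr]; field_simp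
  have h4 : (fun _ : Fin k => (dilatedPacket j₀ hl0 : EuclideanSpace ℝ (Fin n) → ℂ)) = fun _ y =>
      modulatedGaussian (packetWidth j₀ N) (packetFrequency j₀) hW (l • y) := by
    subst hN
    funext _ y
    exact modulatedGaussian_smul _ hW hl0 y
  rw [h4, maximalBochnerRiesz_comp_smul α (fun _ => (modulatedGaussian (packetWidth j₀ N)
    (packetFrequency j₀) hW : EuclideanSpace ℝ (Fin n) → ℂ)) hl0]
  have hmono : ∀ u v : ℝ, u ≤ v → Real.pi * (l * u) ≤ Real.pi * (l * v) := fun u v huv => by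
    gcongr
  refine hc N hN1 (l • x) ?_ ?_ fun j hj => ?_
  · rw [PiLp.smul_apply, smul_eq_mul]
    exact hrN ▸ hmono _ _ h1
  · rw [PiLp.smul_apply, smul_eq_mul]
    refine (hmono _ _ h2).trans (le_of_eq ?_)
    rw [← hrN]
    ring
  · rw [PiLp.smul_apply, smul_eq_mul]
    have h5 := (h3 j hj).1
    rw [abs_of_nonneg (by positivity)]
    exact (hmono _ _ (h3 j hj).2).trans hrN.le

/-- The exponents in the lower bound, with everything expressed in terms of `l`. -/
lemma rpow_mul_rpow_passageBox (n : ℕ) {l : ℝ} (hl : 0 < l) (b P : ℝ) :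
    (l ^ (2 * n)) ^ (-b / 2) * ((l ^ (2 * n) / (Real.pi * l)) ^ n) ^ (1 / P) =
      (Real.pi⁻¹) ^ (n * P⁻¹ : ℝ) * l ^ ((n : ℝ) * ((2 * n - 1) * P⁻¹ - b)) := by
  have hpi := Real.pi_pos
  have hNl : l ^ (2 * n) = l ^ (2 * n : ℝ) := by
    rw [← Real.rpow_natCast]
    push_cast
    rfl
  have hrl : l ^ (2 * n) / (Real.pi * l) = Real.pi⁻¹ * l ^ (2 * n - 1 : ℝ) := by
    rw [hNl, Real.rpow_sub_one hl.ne']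
    field_simp
  rw [hrl, ← Real.rpow_natCast _ n, ← Real.rpow_mul (by positivity), Real.mul_rpow (by positivity)
    (by positivity), hNl, ← Real.rpow_mul hl.le, ← Real.rpow_mul hl.le, one_div, mul_left_comm,
    ← Real.rpow_add hl]
  congr 2
  ring

lemma mul_prod_eLpNorm_ne_top {n k : ℕ} (g : SchwartzMap (EuclideanSpace ℝ (Fin n)) ℂ) (C : ℝ≥0)
    (q : Fin k → ℝ≥0∞) : (C : ℝ≥0∞) * ∏ i, eLpNorm g (q i) volume ≠ ⊤ :=
  ENNReal.mul_ne_top ENNReal.coe_ne_top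
    (ENNReal.prod_ne_top fun i _ => (g.eLpNorm_lt_top (q i) volume).ne)

/-- A maximal estimate, tested on the dilated packets, bounds a power of `l` as `l → ∞`. -/
lemma exists_rpow_le_of_maximal_estimate {n k : ℕ} (hk : 1 ≤ k) {α : ℝ} (hα : 0 ≤ α)
    (j₀ : Fin n) {p : ℝ≥0∞} (hp0 : p ≠ 0) (hp : p ≠ ⊤) (q : Fin k → ℝ≥0∞) {C : ℝ≥0}
    (hC : ∀ f : Fin k → SchwartzMap (EuclideanSpace ℝ (Fin n)) ℂ,
      eLpNorm (maximalBochnerRiesz α (fun i => (f i : EuclideanSpace ℝ (Fin n) → ℂ))) p volume ≤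
        (C : ℝ≥0∞) * ∏ i, eLpNorm (f i) (q i) volume) :
    ∃ M : ℝ, ∀ l : ℝ, 1 ≤ l → l ^ ((n : ℝ) *
      ((2 * n - 1) * p.toReal⁻¹ - (2 * α + 1 + ((n : ℝ) - 1) * k))) ≤ M := by
  obtain ⟨c, hc0, hc⟩ := exists_le_maximalBochnerRiesz_dilatedPacket hk hα j₀
  have hpi := Real.pi_pos
  obtain ⟨B, hBtop, hB⟩ : ∃ B : ℝ≥0∞, B ≠ ⊤ ∧ ∀ (l : ℝ) (hl : 0 < l),
      eLpNorm (maximalBochnerRiesz α (fun _ : Fin k =>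
        (dilatedPacket j₀ hl : EuclideanSpace ℝ (Fin n) → ℂ))) p volume ≤ B := by
    refine ⟨C * ∏ i, eLpNorm (dilatedPacket j₀ one_pos) (q i) volume,
      mul_prod_eLpNorm_ne_top _ C q, fun l hl => ?_⟩
    have h := hC fun _ => dilatedPacket j₀ hl
    simp only [eLpNorm_dilatedPacket] at h ⊢
    exact h
  have hm0 : 0 < c * (Real.pi⁻¹) ^ (n * p.toReal⁻¹ : ℝ) := by positivity
  refine ⟨B.toReal / (c * (Real.pi⁻¹) ^ (n * p.toReal⁻¹ : ℝ)), fun l hl => ?_⟩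
  have hl0 : 0 < l := by linarith
  have hlower : eLpNorm ((passageBox j₀ (l ^ (2 * n) / (Real.pi * l))).indicator fun _ =>
      ENNReal.ofReal (c * (l ^ (2 * n)) ^ (-(α + 1 / 2) - ((n : ℝ) - 1) * k / 2))) p volume ≤
      B := by
    refine (eLpNorm_mono_enorm fun x => ?_).trans (hB l hl0)
    by_cases hx : x ∈ passageBox j₀ (l ^ (2 * n) / (Real.pi * l))
    · rw [Set.indicator_of_mem hx]
      exact hc l hl x hx
    · rw [Set.indicator_of_notMem hx]
      simp
  rw [eLpNorm_indicator_const (measurableSet_passageBox j₀ _) hp0 hp, volume_passageBox] at hlower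
  have hreal := ENNReal.toReal_mono hBtop hlower
  rw [ENNReal.toReal_mul, ← ENNReal.toReal_rpow, ENNReal.toReal_pow,
    ENNReal.toReal_ofReal (by positivity), enorm_eq_self, ENNReal.toReal_ofReal (by positivity),
    show -(α + 1 / 2) - ((n : ℝ) - 1) * k / 2 = -(2 * α + 1 + ((n : ℝ) - 1) * k) / 2 by ring,
    mul_assoc, rpow_mul_rpow_passageBox n hl0, ← mul_assoc] at hreal
  rw [le_div_iff₀ hm0, mul_comm]
  exact hreal

theorem theorem1p3 (n k : ℕ) (hn : 2 ≤ n) (hk : 1 ≤ k) (p : ℝ≥0∞) (hp : 0 < p)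
    (q : Fin k → ℝ≥0∞) (hq : ∀ i, 0 < q i) (α : ℝ) (hα : 0 ≤ α)
    (hlt : α < (2 * (n : ℝ) - 1) / 2 * (p⁻¹).toReal - (((n : ℝ) - 1) * (k : ℝ) + 1) / 2) :
    ¬ ∃ C : ℝ≥0, ∀ f : Fin k → SchwartzMap (EuclideanSpace ℝ (Fin n)) ℂ,
      eLpNorm (maximalBochnerRiesz α (fun i => (f i : EuclideanSpace ℝ (Fin n) → ℂ))) p volume ≤
        (C : ℝ≥0∞) * ∏ i, eLpNorm (f i) (q i) volume := by
  rintro ⟨C, hC⟩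
  have hn2 : (2 : ℝ) ≤ n := by exact_mod_cast hn
  have hptop : p ≠ ⊤ := by
    rintro rfl
    rw [ENNReal.inv_top, ENNReal.toReal_zero, mul_zero] at hlt
    have : 0 ≤ ((n : ℝ) - 1) * k := mul_nonneg (by linarith) (by positivity)
    linarith
  obtain ⟨M, hM⟩ := exists_rpow_le_of_maximal_estimate hk hα ⟨0, by omega⟩ hp.ne' hptop q hC
  rw [ENNReal.toReal_inv] at hlt
  have hpos : 0 < (n : ℝ) *
      ((2 * n - 1) * p.toReal⁻¹ - (2 * α + 1 + ((n : ℝ) - 1) * k)) :=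
    mul_pos (by linarith) (by linarith)
  obtain ⟨l, hl1, hl2⟩ := ((Filter.eventually_ge_atTop 1).and
    ((tendsto_rpow_atTop hpos).eventually_gt_atTop M)).exists
  exact absurd (hM l hl1) (not_le.2 hl2)
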